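/- **System.** Let $p$ source nodes encode their bit streams with polynomial generator rows $G_i(D)\in\mathbb F_2[D]^{1\times s}$ ($i=1,\dots,p$, $s\ge1$) that are linearly independent over $\mathbb F_2[D]$. In each trellis step every source feeds one bit into its feedforward shift register of length $\max_k\deg G_{i,k}$; let $m\ge 1$ be the total number of memory elements. The relay XORs the $p$ codewords and feeds the resulting $s$ bits $\mu_n$ of each step serially into the network encoder (the recursive encoder with state $\sigma^{ne}_{n+1}=\sigma^{ne}_n+\mu_n \bmod 2$) and a binary CPFSK modulator with modulation index $h=K/2$, $K$ odd, rectangular frequency pulse and symbol duration $T$. The complex baseband signal is $$s_b(nT+\tau)=\sqrt{2E_s/T}\,\exp\{j(2\pi h\,\sigma^{ne}_n+2\pi h\,\mu_n\tau/T)\},\qquad 0\le\tau<T,$$ with $E_s=rE_b$, where $E_b>0$ is the energy per information bit and $r=p/s$. It is received in white Gaussian noise of double-sided power spectral density $N_0/2>0$ ($2N_0$ for the complex baseband noise). A block has $N$ steps, i.e. $pN$ independent uniform information bits, and starts in the zero state of the super-trellis (joint convolutional encoder together with network encoder). The destination, without side information, performs maximum-likelihood sequence detection over all source blocks. Let $P_b^d$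 be the bit error probability for an infinitely long block, i.e. the $\limsup$ as $N\to\infty$ of the expected fraction of wrong information bits. **Error events.** The reduced product state of two paths is $(\sigma^{cc},\hat\sigma^{cc},\omega)$, the two states of the joint convolutional encoder together with the difference $\omega$ modulo 2 of the two network-encoder states. An error event is a pair of a transmitted and a competing path of the super-trellis that leave a common state with different inputs and whose reduced product state satisfies $\sigma^{cc}=\hat\sigma^{cc}$, $\omega=0$ again for the first time at the end of the event. Time and length are counted in information bits: the event starts at time $j\in\{0,\dots,p-1\}$ if its first wrong bit is the $j$-th bit of its first step, and its length $\iota$ is $p$ times its number of trellis steps. Its number of symbol errors $\tau$ is the number of wrong information bits, and its normalized squared Euclidean distance (NSED) is $d^2=\frac1{4E_s}\int|s_b-\hat s_b|^2dt$ ($=\frac{1}{2E_s}$ times the squared distance of the passband signals). Let $d_{\min}^2$ be the minimum NSED of all error events. Let $W_{j,\kappa,\iota,\tau,d}$ be the number of error events that start at time $j$ from the joint encoder state $s_\kappa$ (with network-encoder state $0$) and have length $\iota$, $\tau$ symbol errors and NSED $d^2$, and let $$F(\eta,\epsilon,\zeta)=2^{-m}\,\frac1p\sum_{j=0}^{p-1}\sum_{\kappa=1}^{2^m}\sum_{\iota}\sum_{\tau}\sum_{d}W_{j,\kappa,\iota,\tau,d}\,\eta^{\iota}\epsilon^{\tau}\zeta^{d^2}.$$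 **Theorem.** Suppose that the series $F$ converges at $\eta=\tfrac12$, $\epsilon=1$, $\zeta=e^{-E_br/(2N_0)}$ (otherwise the bound is $+\infty$). Then $\epsilon\mapsto F(\tfrac12,\epsilon,e^{-E_br/(2N_0)})$ is differentiable at $\epsilon=1$, and $$P_b^d<Q\!\left(\sqrt{d_{\min}^2\frac{E_br}{N_0}}\right)\exp\!\left(d_{\min}^2\frac{E_br}{2N_0}\right)\left.\frac{\partial F(\eta,\epsilon,\zeta)}{\partial\epsilon}\right|_{\eta=1/2,\ \epsilon=1,\ \zeta=e^{-E_br/(2N_0)}},$$ where $Q(x)=\frac1{\sqrt{2\pi}}\int_x^\infty e^{-z^2/2}\,dz$. -/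

import Mathlib

open MeasureTheory ProbabilityTheory Filter Polynomial

noncomputable section

namespace DistCPFSK

/-! ### The joint distributed convolutional encoder

`p` source nodes, source `i` encoding its bit stream with the polynomial generator row `G i`
(`s` output bits per input bit); the relay adds the `p` codewords over GF(2). -/

/-- One input bit for every source node. -/
abbrev Inp (p : ℕ) := Fin p → ZMod 2

/-- The generator rows of the source encoders. -/
abbrev Gen (p s : ℕ) := Fin p → Fin s → (ZMod 2)[X]

/-- A source block of `N` trellis steps, i.e. `p * N` information bits. -/
abbrev Msg (p N : ℕ) := Fin N → Inp p

variable {p s : ℕ}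

/-- Number of memory elements of the encoder of source `i`. -/
def mem (G : Gen p s) (i : Fin p) : ℕ := Finset.univ.sup fun k => (G i k).natDegree

/-- Total number `m` of memory elements of the joint encoder. -/
def memory (G : Gen p s) : ℕ := ∑ i, mem G i

/-- States of the joint encoder: the contents of the shift registers, most recent bit first.
There are `2 ^ memory G` of them. -/
abbrev JState (G : Gen p s) := (i : Fin p) → Fin (mem G i) → ZMod 2

/-- Shift the input bits into the registers. -/
def nextState (G : Gen p s) (σ : JState G) (x : Inp p) : JState G :=
  fun i d => if d.val = 0 then x i else σ i ⟨d.val - 1, by have := d.isLt; omega⟩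

/-- The `k`-th of the `s` relay code bits in one step: XOR of the source code bits. -/
def outBit (G : Gen p s) (σ : JState G) (x : Inp p) (k : Fin s) : ZMod 2 :=
  ∑ i, ((G i k).coeff 0 * x i + ∑ d : Fin (mem G i), (G i k).coeff (d.val + 1) * σ i d)

/-- State of the joint encoder after `t` steps. -/
def stateAt (G : Gen p s) (σ : JState G) (u : ℕ → Inp p) : ℕ → JState G
  | 0 => σ
  | t + 1 => nextState G (stateAt G σ u t) (u t)

/-- The stream of binary symbols `μ_n` fed into the network encoder, `s` symbols per step. -/
def symbol [NeZero s] (G : Gen p s) (σ : JState G) (u : ℕ → Inp p) (n : ℕ) : ZMod 2 :=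
  outBit G (stateAt G σ u (n / s)) (u (n / s)) (Fin.ofNat s n)

/-- A finite block continued by zeros. -/
def extend {L : ℕ} (u : Msg p L) (t : ℕ) : Inp p := if h : t < L then u ⟨t, h⟩ else 0

/-! ### Network encoder and CPFSK modulator -/

/-- State of the recursive network encoder before symbol `n`: the sum modulo 2 of the previous
symbols. -/
def rscState (μ : ℕ → ZMod 2) : ℕ → ZMod 2
  | 0 => 0
  | n + 1 => rscState μ n + μ n

/-- Phase response on `[0, T]` of the rectangular frequency pulse `1 / (2T)` of length `T`. -/
def phaseResponse (T τ : ℝ) : ℝ := τ / (2 * T)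

/-- Tilted information-carrying phase of binary CPFSK with modulation index `h = K / 2` (phase
modulus 2) at time `t ≥ 0`. The data-independent term vanishes for binary symbols and this pulse. -/
def phase (K : ℕ) (T : ℝ) (μ : ℕ → ZMod 2) (t : ℝ) : ℝ :=
  let n := ⌊t / T⌋₊
  2 * Real.pi * ((K : ℝ) / 2) * ((rscState μ n).val : ℝ) +
    4 * Real.pi * ((K : ℝ) / 2) * ((μ n).val : ℝ) * phaseResponse T (t - n * T)

/-- Unit-amplitude complex envelope. -/
def envelope [NeZero s] (G : Gen p s) (K : ℕ) (T : ℝ) (σ : JState G) (u : ℕ → Inp p) (t : ℝ) : ℂ :=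
  Complex.exp (Complex.I * (phase K T (symbol G σ u) t : ℂ))

/-- Complex baseband signal sent by the relay for the source block `u`, with energy `Es` per CPFSK
symbol; the super-trellis starts in its zero state. -/
def signal [NeZero s] (G : Gen p s) (K : ℕ) (T Es : ℝ) {N : ℕ} (u : Msg p N) : ℝ → ℂ :=
  Set.indicator (Set.Ico 0 (N * s * T)) fun t =>
    (√(2 * Es / T) : ℂ) * envelope G K T 0 (extend u) t

/-! ### AWGN channel and maximum-likelihood sequence detection -/

/-- Real inner product of complex baseband signals. -/
def corr (f g : ℝ → ℂ) : ℝ := ∫ t, ((starRingEnd ℂ) (f t) * g t).re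

/-- `Z f` stands for `Re ∫ conj (n_b t) * f t dt`, where `n_b` is complex baseband white Gaussian
noise of double-sided power spectral density `2 * N0` (passband: `N0 / 2`). -/
structure IsWhiteNoise {Ω : Type*} [MeasurableSpace Ω] (P : Measure Ω) (N0 : ℝ)
    (Z : (ℝ → ℂ) → Ω → ℝ) : Prop where
  gaussian : IsGaussianProcess
    (fun (f : {f : ℝ → ℂ // MemLp f 2 (volume : Measure ℝ)}) => Z f.1) P
  mean : ∀ f : ℝ → ℂ, MemLp f 2 (volume : Measure ℝ) → ∫ ω, Z f ω ∂P = 0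
  covariance : ∀ f g : ℝ → ℂ, MemLp f 2 (volume : Measure ℝ) → MemLp g 2 (volume : Measure ℝ) →
    cov[Z f, Z g; P] = N0 * corr f g

/-- Correlator outputs `v ↦ Re ⟨r_b, s_v⟩` for the received signal `r_b = s_u + n_b`;
they are a sufficient statistic. -/
def received [NeZero s] {Ω : Type*} (G : Gen p s) (K : ℕ) (T Es : ℝ) (Z : (ℝ → ℂ) → Ω → ℝ) {N : ℕ}
    (u : Msg p N) (ω : Ω) : Msg p N → ℝ :=
  fun v => corr (signal G K T Es u) (signal G K T Es v) + Z (signal G K T Es v) ω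

/-- Maximum-likelihood sequence detection over all source blocks of `N` steps: the decision
maximizes the log-likelihood `(Re ⟨r_b, s_v⟩ - ‖s_v‖² / 2) / N0`; ties are broken arbitrarily. -/
structure IsMLSD [NeZero s] (G : Gen p s) (K : ℕ) (T Es : ℝ) {N : ℕ}
    (dec : (Msg p N → ℝ) → Msg p N) : Prop where
  measurable : ∀ v, MeasurableSet (dec ⁻¹' {v})
  maximal : ∀ (y : Msg p N → ℝ) (v : Msg p N),
    y v - corr (signal G K T Es v) (signal G K T Es v) / 2 ≤
      y (dec y) - corr (signal G K T Es (dec y)) (signal G K T Es (dec y)) / 2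

/-- Number of information bits in which two blocks differ. -/
def bitErrors {N : ℕ} (u v : Msg p N) : ℕ :=
  (Finset.univ.filter fun x : Fin N × Fin p => u x.1 x.2 ≠ v x.1 x.2).card

/-- Expected fraction of wrong information bits in a block of `N` steps, all `2 ^ (p * N)` source
blocks being equally likely. -/
def blockBER [NeZero s] {Ω : Type*} [MeasurableSpace Ω] (P : Measure Ω) (G : Gen p s) (K : ℕ)
    (T Es : ℝ) (Z : (ℝ → ℂ) → Ω → ℝ) {N : ℕ} (dec : (Msg p N → ℝ) → Msg p N) : ℝ :=
  (2 ^ (p * N) : ℝ)⁻¹ * ∑ u : Msg p N,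
    ∫ ω, (bitErrors u (dec (received G K T Es Z u ω)) : ℝ) / ((p : ℝ) * N) ∂P

/-- Bit error probability of the relay-to-destination link for an infinitely long block. -/
def bitErrorProb [NeZero s] {Ω : Type*} [MeasurableSpace Ω] (P : Measure Ω) (G : Gen p s) (K : ℕ)
    (T Es : ℝ) (Z : (ℝ → ℂ) → Ω → ℝ) (dec : (N : ℕ) → (Msg p N → ℝ) → Msg p N) : ℝ :=
  limsup (fun N => blockBER P G K T Es Z (dec N)) atTop

/-! ### Error events in the reduced product-state diagram -/

/-- Reduced product state after `t` steps of two paths leaving the same super-trellis state: the two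
joint-encoder states and the difference phase state. -/
def productState [NeZero s] (G : Gen p s) (σ : JState G) (u v : ℕ → Inp p) (t : ℕ) :
    JState G × JState G × ZMod 2 :=
  (stateAt G σ u t, stateAt G σ v t,
    rscState (symbol G σ u) (t * s) - rscState (symbol G σ v) (t * s))

/-- The product states in which error events start and end. -/
def IsMerged {G : Gen p s} (x : JState G × JState G × ZMod 2) : Prop :=
  x.1 = x.2.1 ∧ x.2.2 = 0

/-- An error event: a transmitted and a competing path that leave a common state with different
inputs and whose product state is merged again for the first time after `len` trellis steps. -/
structure ErrorEvent [NeZero s] (G : Gen p s) where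
  start : JState G
  len : ℕ
  sent : Msg p len
  decoded : Msg p len
  len_pos : 0 < len
  diverge : extend sent 0 ≠ extend decoded 0
  unmerged : ∀ t, 0 < t → t < len → ¬ IsMerged (productState G start (extend sent) (extend decoded) t)
  merge : IsMerged (productState G start (extend sent) (extend decoded) len)

/-- The event starts at (bit) time `j` of its first step: the first wrong bit is that of source
`j`. -/
def ErrorEvent.StartsAt [NeZero s] {G : Gen p s} (e : ErrorEvent G) (j : Fin p) : Prop :=
  (∀ k < j, extend e.sent 0 k = extend e.decoded 0 k) ∧ extend e.sent 0 j ≠ extend e.decoded 0 j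

/-- Normalized squared Euclidean distance: the squared distance of the two transmitted signals
divided by twice the energy per CPFSK symbol. -/
def ErrorEvent.nsed [NeZero s] {G : Gen p s} (e : ErrorEvent G) (K : ℕ) (T : ℝ) : ℝ :=
  1 / (2 * T) * ∫ t in (0 : ℝ)..(e.len * s * T),
    ‖envelope G K T e.start (extend e.sent) t - envelope G K T e.start (extend e.decoded) t‖ ^ 2

/-- Minimum normalized squared Euclidean distance. -/
def dminSq [NeZero s] (G : Gen p s) (K : ℕ) (T : ℝ) : ℝ :=
  sInf (Set.range fun e : ErrorEvent G => e.nsed K T)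

/-- Number of error events starting at time `j` from state `σ` that have length `ι`, `τ` bit errors
and NSED `D`. Lengths are counted in information bits, `p` for each trellis step. -/
def eventCount [NeZero s] (G : Gen p s) (K : ℕ) (T : ℝ) (j : Fin p) (σ : JState G) (ι τ : ℕ)
    (D : ℝ) : ℕ :=
  Nat.card {e : ErrorEvent G // e.StartsAt j ∧ e.start = σ ∧ p * e.len = ι ∧
    bitErrors e.sent e.decoded = τ ∧ e.nsed K T = D}

/-- The terms of the transfer function for start time `j` and start state `σ`. -/
def transferTerm [NeZero s] (G : Gen p s) (K : ℕ) (T : ℝ) (j : Fin p) (σ : JState G) (η ε ζ : ℝ)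
    (x : ℕ × ℕ × ℝ) : ℝ :=
  (eventCount G K T j σ x.1 x.2.1 x.2.2 : ℝ) * η ^ x.1 * ε ^ x.2.1 * ζ ^ x.2.2

/-- The average transfer function `F(η, ε, ζ)`. -/
def transferFunction [NeZero s] (G : Gen p s) (K : ℕ) (T : ℝ) (η ε ζ : ℝ) : ℝ :=
  (2 ^ memory G : ℝ)⁻¹ * (1 / (p : ℝ)) *
    ∑ j : Fin p, ∑ σ : JState G, ∑' x : ℕ × ℕ × ℝ, transferTerm G K T j σ η ε ζ x

/-- Gaussian tail function. -/
def gaussQ (x : ℝ) : ℝ := (√(2 * Real.pi))⁻¹ * ∫ z in Set.Ioi x, Real.exp (-z ^ 2 / 2)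

end DistCPFSK

end

noncomputable section

namespace DistCPFSK

/-! ### The Gaussian tail function -/

/-! The proof is a union bound over error events, made possible by linearity. Encoder and network
encoder are linear over GF(2), and for odd `K` the squared distance over one symbol interval depends
only on the differences of phase state and symbol (`integral_cpfsk_symbol`). A pair of paths can
therefore be replaced by one trajectory of the difference system `DState`. Merging means that this
trajectory is at 0, and the NSED is its integer `pathCost`. For every difference word of `L` steps
there are 2^(pL) transmitted words; this cancels η^(pL) at η = 1/2, so `F` is a sum over
`EventWord`.

Every wrong bit lies in an excursion of the difference trajectory away from 0, which either returns
to 0 (an error event) or is cut off by the end of the block. If the detector chose `v`, then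
replacing the excursion in `v` by the transmitted segment changes the signal just as removing it
from the wrongly modified transmitted block does (`signal_exchange`). Hence, almost surely,
optimality of `v` forces a pairwise error that involves this single excursion
(`ae_mem_segmentError`). A terminated excursion at distance D has pairwise probability Q(√(D Es/N0))
and can be placed at no more than N times.

The unterminated excursions must contribute a bounded amount. Convergence of `F` makes the
first-passage weights into 0 finite, and for a finite automaton this forces exponential decay of the
weight of paths avoiding 0 (`avoidOp_exponential_decay`). The boundary term is then O(1) and
disappears after division by N. The same decay gives convergence for some ε > 1, hence
differentiability at ε = 1.

Finally Q(b) ≤ Q(a) exp((a² - b²)/2) for a ≤ b turns each Q into the stated prefactor times ζ^D.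
Strictness comes from an event with D > d_min²: positive memory gives infinitely many events, and
summability rules out bounded distances. -/

lemma integrable_exp_neg_sq_half_add (x : ℝ) :
    Integrable fun z : ℝ => Real.exp (-(z + x) ^ 2 / 2) := by
  have h := (integrable_exp_neg_mul_sq (b := 1 / 2) (by norm_num)).comp_add_right x
  refine h.congr (Eventually.of_forall fun z => ?_)
  simp only
  congr 1
  ring

lemma gaussQ_eq_integral_shift (x : ℝ) :
    gaussQ x = (√(2 * Real.pi))⁻¹ * ∫ z in Set.Ioi (0 : ℝ), Real.exp (-(z + x) ^ 2 / 2) := by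
  unfold gaussQ
  congr 1
  have := (measurePreserving_add_right (volume : Measure ℝ) x).setIntegral_preimage_emb
    (MeasurableEquiv.addRight x).measurableEmbedding (fun z => Real.exp (-z ^ 2 / 2)) (Set.Ioi x)
  rw [← this]
  congr 2
  ext z
  simp

lemma gaussQ_pos (x : ℝ) : 0 < gaussQ x := by
  rw [gaussQ_eq_integral_shift]
  refine mul_pos (by positivity) ?_
  rw [setIntegral_pos_iff_support_of_nonneg_ae
    (Eventually.of_forall fun z => (Real.exp_pos _).le)
    (integrable_exp_neg_sq_half_add x).integrableOn]
  have : Function.support (fun z : ℝ => Real.exp (-(z + x) ^ 2 / 2)) = Set.univ := by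
    ext z; simp [(Real.exp_pos _).ne']
  simp [this]

/-- After shifting both integrals to (0, ∞), (z+b)² = (z+a)² + (b² - a²) + 2z(b-a), and the factor
exp(-z(b-a)) is below 1. With a² the scaled minimum distance this produces the prefactor of the
final bound and its strictness. -/
lemma gaussQ_lt_mul_exp {a b : ℝ} (hab : a < b) :
    gaussQ b < gaussQ a * Real.exp ((a ^ 2 - b ^ 2) / 2) := by
  rw [gaussQ_eq_integral_shift, gaussQ_eq_integral_shift, mul_assoc, ← integral_mul_const]
  refine mul_lt_mul_of_pos_left ?_ (by positivity)
  rw [← sub_pos, ← integral_sub ((integrable_exp_neg_sq_half_add a).integrableOn.mul_const _)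
    (integrable_exp_neg_sq_half_add b).integrableOn]
  have key : ∀ z : ℝ, Real.exp (-(z + b) ^ 2 / 2) =
      Real.exp (-(z + a) ^ 2 / 2) * Real.exp ((a ^ 2 - b ^ 2) / 2) * Real.exp (-(z * (b - a))) := by
    intro z
    rw [← Real.exp_add, ← Real.exp_add]
    congr 1
    ring
  have hpos : ∀ z ∈ Set.Ioi (0 : ℝ), 0 <
      Real.exp (-(z + a) ^ 2 / 2) * Real.exp ((a ^ 2 - b ^ 2) / 2) -
        Real.exp (-(z + b) ^ 2 / 2) := by
    intro z hz
    rw [key z, ← mul_one_sub]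
    refine mul_pos (by positivity) ?_
    rw [sub_pos, Real.exp_lt_one_iff, neg_lt_zero]
    exact mul_pos hz (sub_pos.2 hab)
  rw [setIntegral_pos_iff_support_of_nonneg_ae]
  · refine lt_of_lt_of_le ?_ (measure_mono (s := Set.Ioi (0 : ℝ)) fun z hz => ⟨(hpos z hz).ne', hz⟩)
    simp
  · exact (ae_restrict_iff' measurableSet_Ioi).2 (Eventually.of_forall fun z hz => (hpos z hz).le)
  · exact ((integrable_exp_neg_sq_half_add a).mul_const _).integrableOn.sub
      (integrable_exp_neg_sq_half_add b).integrableOn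

lemma gaussQ_le_mul_exp {a b : ℝ} (hab : a ≤ b) :
    gaussQ b ≤ gaussQ a * Real.exp ((a ^ 2 - b ^ 2) / 2) := by
  rcases hab.eq_or_lt with rfl | h
  · simp
  · exact (gaussQ_lt_mul_exp h).le

lemma gaussianReal_Ici {v : NNReal} (hv : v ≠ 0) (t : ℝ) :
    (gaussianReal 0 v).real (Set.Ici t) = gaussQ (t / √v) := by
  have hv' : 0 < √(v : ℝ) := Real.sqrt_pos.2 (by positivity)
  have hmap : gaussianReal 0 v = (gaussianReal 0 1).map (fun x => √(v : ℝ) * x) := by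
    rw [gaussianReal_map_const_mul]
    congr 1
    · simp
    · ext; simp
  rw [hmap, map_measureReal_apply (by fun_prop) measurableSet_Ici]
  have hpre : (fun x => √(v : ℝ) * x) ⁻¹' Set.Ici t = Set.Ici (t / √v) := by
    ext x
    simp [div_le_iff₀' hv']
  rw [hpre, measureReal_def, gaussianReal_apply_eq_integral 0 one_ne_zero, ENNReal.toReal_ofReal
    (integral_nonneg fun x => gaussianPDFReal_nonneg _ _ _), integral_Ici_eq_integral_Ioi, gaussQ,
    ← integral_const_mul]
  congr 1
  ext x
  simp [gaussianPDFReal_def]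

lemma gaussQ_zero_le_one : gaussQ 0 ≤ 1 := by
  have h := gaussianReal_Ici (v := 1) one_ne_zero 0
  simp only [zero_div] at h
  rw [← h]
  exact measureReal_le_one

lemma gaussQ_sqrt_le {x : ℝ} (hx : 0 ≤ x) : gaussQ (√x) ≤ Real.exp (-(x / 2)) := by
  refine (gaussQ_le_mul_exp (Real.sqrt_nonneg x)).trans ?_
  rw [Real.sq_sqrt hx]
  refine (mul_le_of_le_one_left (Real.exp_pos _).le gaussQ_zero_le_one).trans (le_of_eq ?_)
  congr 1
  ring

end DistCPFSK
end

noncomputable section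

namespace DistCPFSK

/-! ### Weighted finite automata -/

section Automaton

open scoped ENNReal

variable {S I : Type*} [Fintype I] (step : S → I → S) (wt : S → I → ℝ≥0∞) (z : S)

open Classical in
/-- The weighted transition operator of an automaton, without the transitions into `z`. -/
def avoidOp : Module.End ℝ≥0∞ (S → ℝ≥0∞) where
  toFun f x := ∑ a, if step x a = z then 0 else wt x a * f (step x a)
  map_add' f g := by
    ext x
    simp only [Pi.add_apply, ← Finset.sum_add_distrib]
    refine Finset.sum_congr rfl fun a _ => ?_
    split_ifs <;> simp [mul_add]
  map_smul' c f := by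
    ext x
    simp only [Pi.smul_apply, smul_eq_mul, RingHom.id_apply, Finset.mul_sum]
    refine Finset.sum_congr rfl fun a _ => ?_
    split_ifs <;> simp [mul_left_comm]

open Classical in
/-- The total weight of the transitions into `z`. -/
def hitWeight (x : S) : ℝ≥0∞ := ∑ a, if step x a = z then wt x a else 0

variable {step wt z}

open Classical in
lemma avoidOp_apply (f : S → ℝ≥0∞) (x : S) :
    avoidOp step wt z f x = ∑ a, if step x a = z then 0 else wt x a * f (step x a) := rfl

open Classical in
lemma hitWeight_apply (x : S) :
    hitWeight step wt z x = ∑ a, if step x a = z then wt x a else 0 := rfl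

lemma avoidOp_mono {R : S → Prop} (hR : ∀ x a, R x → R (step x a)) {f g : S → ℝ≥0∞}
    (hfg : ∀ x, R x → f x ≤ g x) {x : S} (hx : R x) :
    avoidOp step wt z f x ≤ avoidOp step wt z g x := by
  classical
  simp only [avoidOp_apply]
  refine Finset.sum_le_sum fun a _ => ?_
  split_ifs
  · rfl
  · gcongr
    exact hfg _ (hR _ _ hx)

/-- The comparison is restricted to a closed set `R` because finiteness and positivity will only be
known on the reachable states. -/
lemma avoidOp_pow_mono {R : S → Prop} (hR : ∀ x a, R x → R (step x a)) {f g : S → ℝ≥0∞}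
    (hfg : ∀ x, R x → f x ≤ g x) (n : ℕ) {x : S} (hx : R x) :
    ((avoidOp step wt z) ^ n) f x ≤ ((avoidOp step wt z) ^ n) g x := by
  induction n generalizing x with
  | zero => simpa using hfg x hx
  | succ n ih =>
    simp only [pow_succ', Module.End.mul_apply]
    exact avoidOp_mono hR (fun y hy => ih hy) hx

lemma avoidOp_tsum (f : ℕ → S → ℝ≥0∞) (x : S) :
    avoidOp step wt z (fun y => ∑' n, f n y) x = ∑' n, avoidOp step wt z (f n) x := by
  classical
  simp only [avoidOp_apply]
  rw [Summable.tsum_finsetSum fun _ _ => ENNReal.summable]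
  refine Finset.sum_congr rfl fun a _ => ?_
  split_ifs
  · simp
  · rw [ENNReal.tsum_mul_left]

/-- Finiteness of the total first-passage weight into `z` from all states of a closed set `R`, from
each of which `z` can be reached, implies that the weight of the paths avoiding `z` decays
exponentially. -/
theorem avoidOp_exponential_decay [Finite S] {R : S → Prop} (hR : ∀ x a, R x → R (step x a))
    (hfin : ∀ x, R x → ∑' n, ((avoidOp step wt z) ^ n) (hitWeight step wt z) x ≠ ∞)
    (hpos : ∀ x, R x → ∑' n, ((avoidOp step wt z) ^ n) (hitWeight step wt z) x ≠ 0) :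
    ∃ ρ C : ℝ≥0∞, ρ < 1 ∧ C ≠ ∞ ∧ ∀ n x, R x → ((avoidOp step wt z) ^ n) 1 x ≤ C * ρ ^ n := by
  classical
  have := Fintype.ofFinite S
  set M := avoidOp step wt z with hM
  set b := hitWeight step wt z with hb
  have hex : ∀ x, ∃ n, R x → (M ^ n) b x ≠ 0 := by
    intro x
    by_cases hx : R x
    · by_contra! h
      exact hpos x hx (by simp [fun n => (h n).2])
    · exact ⟨0, fun h => absurd h hx⟩
  choose k hk using hex
  obtain ⟨n₀, hn₀⟩ : ∃ n₀, ∀ x, k x < n₀ :=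
    ⟨Finset.univ.sup k + 1, fun x => Nat.lt_succ_of_le (Finset.le_sup (Finset.mem_univ x))⟩
  -- A partial first-passage sum long enough to be positive on all of `R`. A multiple `B • t` then
  -- dominates 1 there, so path weights are controlled by first-passage weights.
  set t : S → ℝ≥0∞ := ∑ i ∈ Finset.range n₀, (M ^ i) b with ht
  have ht0 : ∀ x, R x → t x ≠ 0 := by
    intro x hx h0
    rw [ht, Finset.sum_apply, Finset.sum_eq_zero_iff] at h0
    exact hk x hx (h0 (k x) (Finset.mem_range.2 (hn₀ x)))
  have htfin : ∀ x, R x → t x ≠ ∞ := by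
    intro x hx
    refine ne_top_of_le_ne_top (hfin x hx) ?_
    rw [ht, Finset.sum_apply]
    exact ENNReal.sum_le_tsum _
  set B : ℝ≥0∞ := ∑ x, if R x then (t x)⁻¹ else 0 with hB
  have hBfin : B ≠ ∞ := by
    rw [hB, ENNReal.sum_ne_top]
    intro x _
    split_ifs with hx
    · simpa using ht0 x hx
    · simp
  have hone : ∀ x, R x → (1 : S → ℝ≥0∞) x ≤ (B • t) x := by
    intro x hx
    calc (1 : ℝ≥0∞) = (t x)⁻¹ * t x := (ENNReal.inv_mul_cancel (ht0 x hx) (htfin x hx)).symm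
      _ ≤ B * t x := by
          gcongr
          rw [hB]
          refine le_trans ?_ (Finset.single_le_sum (f := fun x => if R x then (t x)⁻¹ else 0)
            (fun _ _ => zero_le) (Finset.mem_univ x))
          simp [hx]
  set h : S → ℝ≥0∞ := fun x => ∑' n, (M ^ n) 1 x with hh
  have hhfin : ∀ x, R x → h x ≠ ∞ := by
    intro x hx
    have h1 : h x ≤ B * ∑' n, (M ^ n) t x := by
      rw [← ENNReal.tsum_mul_left]
      refine ENNReal.tsum_le_tsum fun n => (avoidOp_pow_mono hR hone n hx).trans ?_
      rw [map_smul]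
      rfl
    -- Each of the `n₀` summands of `t` contributes a tail of the first-passage series.
    have h2 : ∑' n, (M ^ n) t x ≤ n₀ * ∑' n, (M ^ n) b x := by
      simp only [ht, map_sum, Finset.sum_apply]
      rw [Summable.tsum_finsetSum fun _ _ => ENNReal.summable]
      refine (Finset.sum_le_card_nsmul _ _ (∑' n, (M ^ n) b x) fun i _ => ?_).trans (by simp)
      simp only [← Module.End.mul_apply, ← pow_add]
      exact ENNReal.tsum_comp_le_tsum_of_injective (add_left_injective i)
        (fun n => (M ^ n) b x)
    refine ne_top_of_le_ne_top ?_ (h1.trans (mul_le_mul_right h2 B))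
    exact ENNReal.mul_ne_top hBfin (ENNReal.mul_ne_top (by simp) (hfin x hx))
  have hrec : ∀ x, h x = 1 + M h x := by
    intro x
    have h1 : M h x = ∑' n, (M ^ (n + 1)) 1 x := by
      simp only [hh, hM, avoidOp_tsum, pow_succ', Module.End.mul_apply]
    rw [h1, hh]
    simp only
    rw [tsum_eq_zero_add' ENNReal.summable]
    simp
  -- The leading 1 only keeps `H` nonzero, so that `H⁻¹` is finite.
  set H : ℝ≥0∞ := 1 + ∑ x, if R x then h x else 0 with hH
  have hHfin : H ≠ ∞ := by
    rw [hH]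
    refine ENNReal.add_ne_top.2 ⟨by simp, ?_⟩
    rw [ENNReal.sum_ne_top]
    intro x _
    split_ifs with hx
    · exact hhfin x hx
    · simp
  have hle : ∀ x, R x → h x ≤ H := by
    intro x hx
    refine le_trans ?_ le_add_self
    refine le_trans ?_ (Finset.single_le_sum (f := fun x => if R x then h x else 0)
      (fun _ _ => zero_le) (Finset.mem_univ x))
    simp [hx]
  have hH0 : H ≠ 0 := by simp [hH]
  -- From h = 1 + M h and h ≤ H: M h = h - 1 ≤ (1 - 1/H) h. So `h` is a Lyapunov function for `M`
  -- with a contraction factor below 1.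
  have hcontr : ∀ x, R x → M h x ≤ ((1 - H⁻¹) • h) x := by
    intro x hx
    rw [Pi.smul_apply, smul_eq_mul, ENNReal.sub_mul fun _ _ => hhfin x hx, one_mul]
    refine ENNReal.le_sub_of_add_le_right
      (ENNReal.mul_ne_top (by simpa using hH0) (hhfin x hx)) ?_
    calc M h x + H⁻¹ * h x ≤ M h x + H⁻¹ * H := by gcongr; exact hle x hx
      _ = h x := by rw [ENNReal.inv_mul_cancel hH0 hHfin, add_comm, ← hrec x]
  refine ⟨1 - H⁻¹, H, ENNReal.sub_lt_self (by simp) (by simp) (by simpa using hHfin), hHfin, ?_⟩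
  have hiter : ∀ n x, R x → (M ^ n) h x ≤ (1 - H⁻¹) ^ n * h x := by
    intro n
    induction n with
    | zero => intro x _; simp
    | succ n ih =>
      intro x hx
      rw [pow_succ, Module.End.mul_apply]
      refine (avoidOp_pow_mono hR hcontr n hx).trans ?_
      rw [map_smul, Pi.smul_apply, smul_eq_mul, pow_succ', mul_assoc]
      gcongr
      exact ih x hx
  intro n x hx
  calc (M ^ n) 1 x ≤ (M ^ n) h x := by
        refine avoidOp_pow_mono hR (fun y _ => ?_) n hx
        rw [hrec y]
        exact le_self_add
    _ ≤ (1 - H⁻¹) ^ n * h x := hiter n x hx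
    _ ≤ (1 - H⁻¹) ^ n * H := by gcongr; exact hle x hx
    _ = H * (1 - H⁻¹) ^ n := mul_comm _ _

end Automaton

end DistCPFSK
end

noncomputable section

namespace DistCPFSK

variable {p s : ℕ}

/-! ### Linearity of the encoders -/

lemma nextState_sub (G : Gen p s) (σ σ' : JState G) (x y : Inp p) :
    nextState G (σ - σ') (x - y) = nextState G σ x - nextState G σ' y := by
  funext i d
  simp only [nextState, Pi.sub_apply]
  split_ifs <;> rfl

lemma outBit_sub (G : Gen p s) (σ σ' : JState G) (x y : Inp p) (k : Fin s) :
    outBit G (σ - σ') (x - y) k = outBit G σ x k - outBit G σ' y k := by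
  simp only [outBit, ← Finset.sum_sub_distrib, Pi.sub_apply]
  refine Finset.sum_congr rfl fun i _ => ?_
  simp only [mul_sub, Finset.sum_sub_distrib]
  ring

lemma stateAt_sub (G : Gen p s) (σ σ' : JState G) (u v : ℕ → Inp p) (t : ℕ) :
    stateAt G (σ - σ') (u - v) t = stateAt G σ u t - stateAt G σ' v t := by
  induction t with
  | zero => rfl
  | succ t ih => simp only [stateAt, ih, Pi.sub_apply, nextState_sub]

lemma symbol_sub [NeZero s] (G : Gen p s) (σ σ' : JState G) (u v : ℕ → Inp p) :
    symbol G (σ - σ') (u - v) = symbol G σ u - symbol G σ' v := by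
  funext n
  simp only [symbol, stateAt_sub, Pi.sub_apply, outBit_sub]

lemma rscState_sub (μ ν : ℕ → ZMod 2) (n : ℕ) :
    rscState (μ - ν) n = rscState μ n - rscState ν n := by
  induction n with
  | zero => simp [rscState]
  | succ n ih => simp only [rscState, ih, Pi.sub_apply]; ring

lemma rscState_add (μ : ℕ → ZMod 2) (n k : ℕ) :
    rscState μ (n + k) = rscState μ n + rscState (fun i => μ (n + i)) k := by
  induction k with
  | zero => simp [rscState]
  | succ k ih => rw [← add_assoc, rscState, ih, rscState]; ring

lemma rscState_congr {μ ν : ℕ → ZMod 2} {n : ℕ} (h : ∀ i < n, μ i = ν i) :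
    rscState μ n = rscState ν n := by
  induction n with
  | zero => rfl
  | succ n ih => simp only [rscState, ih fun i hi => h i (hi.trans n.lt_succ_self),
      h n n.lt_succ_self]

lemma extend_sub {L : ℕ} (u v : Msg p L) : extend (u - v) = extend u - extend v := by
  funext t
  simp only [extend, Pi.sub_apply]
  split_ifs <;> simp

lemma extend_of_lt {L : ℕ} (u : Msg p L) {t : ℕ} (h : t < L) : extend u t = u ⟨t, h⟩ := by
  simp [extend, h]

/-! ### Nonzero output of nonzero inputs -/

lemma stateAt_zero_apply (G : Gen p s) (u : ℕ → Inp p) (t : ℕ) (i : Fin p) (d : Fin (mem G i)) :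
    stateAt G 0 u t i d = if d.val < t then u (t - 1 - d.val) i else 0 := by
  induction t generalizing d with
  | zero => simp [stateAt]
  | succ t ih =>
    rw [stateAt, nextState]
    split_ifs with h0 h1 h1
    · simp [h0]
    · omega
    · rw [ih, if_pos (by simp only; omega)]
      rw [show t - 1 - (d.val - 1) = t + 1 - 1 - d.val by omega]
    · rw [ih, if_neg (by simp only; omega)]

/-- The register of source `i` holds every past bit that can meet a nonzero coefficient of `G i k`,
so the convolution sum truncates to the register contents. -/
lemma coeff_mul_eq_of_le (G : Gen p s) (i : Fin p) (k : Fin s) (u : ℕ → Inp p) (e : (ZMod 2)[X])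
    (he : ∀ t, e.coeff t = u t i) (t : ℕ) :
    (e * G i k).coeff t = (G i k).coeff 0 * u t i +
      ∑ d : Fin (mem G i), (G i k).coeff (d.val + 1) * stateAt G 0 u t i d := by
  have hdeg : ∀ d, mem G i ≤ d → (G i k).coeff (d + 1) = 0 := fun d hd =>
    coeff_eq_zero_of_natDegree_lt (Nat.lt_succ_of_le
      ((Finset.le_sup (f := fun k => (G i k).natDegree) (Finset.mem_univ k)).trans hd))
  simp only [stateAt_zero_apply]
  rw [mul_comm e, coeff_mul, Finset.Nat.sum_antidiagonal_eq_sum_range_succ_mk,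
    Finset.sum_range_succ', add_comm,
    Fin.sum_univ_eq_sum_range
      (fun d => (G i k).coeff (d + 1) * if d < t then u (t - 1 - d) i else 0)]
  simp only [he, Nat.sub_zero, mul_ite, mul_zero]
  congr 1
  rw [← Finset.sum_filter, ← Finset.sum_filter_add_sum_filter_not (Finset.range t)
    (fun d => d < mem G i)]
  rw [Finset.sum_eq_zero (s := (Finset.range t).filter fun d => ¬ d < mem G i), add_zero]
  · refine Finset.sum_congr ?_ fun d _ => ?_
    · ext d; simp [and_comm]
    · rw [Nat.sub_sub, add_comm 1 d]
  · intro d hd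
    rw [Finset.mem_filter, not_lt] at hd
    simp [hdeg d hd.2]

/-- A terminated input is a vector `e` of polynomials. If all relay bits vanished, also after time
`L` where state and input are 0, then ∑ eᵢ Gᵢ = 0 would be a nontrivial relation. -/
lemma exists_outBit_ne_zero {G : Gen p s} (hG : LinearIndependent (ZMod 2)[X] G) {u : ℕ → Inp p}
    {L : ℕ} (hu : ∀ t, L ≤ t → u t = 0) (hL : stateAt G 0 u L = 0) (hne : u ≠ 0) :
    ∃ t < L, ∃ k, outBit G (stateAt G 0 u t) (u t) k ≠ 0 := by
  by_contra! hcon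
  have hst : ∀ t, stateAt G 0 u (L + t) = 0 := by
    intro t
    induction t with
    | zero => exact hL
    | succ t ih =>
      rw [← add_assoc, stateAt, ih, hu _ (Nat.le_add_right _ _)]
      simpa using nextState_sub G 0 0 0 0
  have hout : ∀ t k, outBit G (stateAt G 0 u t) (u t) k = 0 := by
    intro t k
    rcases lt_or_ge t L with h | h
    · exact hcon t h k
    · obtain ⟨r, rfl⟩ := Nat.exists_eq_add_of_le h
      rw [hst, hu _ h]
      simpa using outBit_sub G 0 0 0 0 k
  set e : Fin p → (ZMod 2)[X] := fun i => ∑ t ∈ Finset.range L, monomial t (u t i) with he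
  have hcoeff : ∀ i t, (e i).coeff t = u t i := by
    intro i t
    simp only [he, finsetSum_coeff, coeff_monomial, Finset.sum_ite_eq', Finset.mem_range]
    split_ifs with h
    · rfl
    · rw [hu t (not_lt.1 h)]; rfl
  have hsum : ∑ i, e i • G i = 0 := by
    funext k
    ext t
    simp only [Finset.sum_apply, Pi.smul_apply, smul_eq_mul, finsetSum_coeff, Pi.zero_apply,
      coeff_zero]
    rw [← hout t k, outBit]
    exact Finset.sum_congr rfl fun i _ => coeff_mul_eq_of_le G i k u (e i) (hcoeff i) t
  have hzero := Fintype.linearIndependent_iff.1 hG e hsum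
  refine hne (funext fun t => funext fun i => ?_)
  rw [← hcoeff i t, hzero i]
  rfl

/-! ### The difference system -/

/-- States of the difference system: the difference of two joint-encoder states together with the
difference of the network-encoder states. -/
abbrev DState (G : Gen p s) := JState G × ZMod 2

variable [NeZero s]

/-- The relay code bits of one trellis step. -/
def stepBits (G : Gen p s) (σ : JState G) (a : Inp p) (n : ℕ) : ZMod 2 :=
  outBit G σ a (Fin.ofNat s n)

/-- One trellis step of the difference system. -/
def dStep (G : Gen p s) (x : DState G) (a : Inp p) : DState G :=
  (nextState G x.1 a, x.2 + rscState (stepBits G x.1 a) s)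

/-- Normalized squared distance over one symbol interval for phase state difference `w` and symbol
difference `δ`. -/
def symCost (w δ : ZMod 2) : ℕ := if δ ≠ 0 then 1 else if w ≠ 0 then 2 else 0

/-- Normalized squared distance over one trellis step. -/
def dCost (G : Gen p s) (x : DState G) (a : Inp p) : ℕ :=
  ∑ k ∈ Finset.range s, symCost (x.2 + rscState (stepBits G x.1 a) k) (stepBits G x.1 a k)

/-- Trajectory of the difference system. -/
def dState (G : Gen p s) (x : DState G) (u : ℕ → Inp p) : ℕ → DState G
  | 0 => x
  | t + 1 => dStep G (dState G x u t) (u t)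

/-- Accumulated normalized squared distance of `L` steps of the difference system. -/
def pathCost (G : Gen p s) (x : DState G) (u : ℕ → Inp p) (L : ℕ) : ℕ :=
  ∑ t ∈ Finset.range L, dCost G (dState G x u t) (u t)

lemma symbol_block (G : Gen p s) (σ : JState G) (u : ℕ → Inp p) (t : ℕ) {k : ℕ} (hk : k < s) :
    symbol G σ u (t * s + k) = stepBits G (stateAt G σ u t) (u t) k := by
  have h1 : (t * s + k) / s = t := by
    rw [mul_comm, Nat.mul_add_div (NeZero.pos s), Nat.div_eq_of_lt hk, add_zero]
  have h2 : Fin.ofNat s (t * s + k) = Fin.ofNat s k := by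
    ext; simp [Fin.ofNat]
  simp only [symbol, stepBits, h1, h2]

lemma rscState_symbol_block (G : Gen p s) (σ : JState G) (u : ℕ → Inp p) (t : ℕ) {k : ℕ}
    (hk : k ≤ s) : rscState (symbol G σ u) (t * s + k) =
      rscState (symbol G σ u) (t * s) + rscState (stepBits G (stateAt G σ u t) (u t)) k := by
  rw [rscState_add]
  congr 1
  exact rscState_congr fun i hi => symbol_block G σ u t (hi.trans_le hk)

lemma dState_eq (G : Gen p s) (σ : JState G) (u : ℕ → Inp p) (t : ℕ) :
    dState G (σ, 0) u t = (stateAt G σ u t, rscState (symbol G σ u) (t * s)) := by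
  induction t with
  | zero => simp [dState, stateAt, rscState]
  | succ t ih =>
    rw [dState, ih, dStep, Nat.succ_mul, rscState_symbol_block G σ u t le_rfl]
    rfl

lemma pathCost_eq (G : Gen p s) (σ : JState G) (u : ℕ → Inp p) (L : ℕ) :
    pathCost G (σ, 0) u L =
      ∑ n ∈ Finset.range (L * s), symCost (rscState (symbol G σ u) n) (symbol G σ u n) := by
  induction L with
  | zero => simp [pathCost]
  | succ L ih =>
    rw [pathCost, Finset.sum_range_succ, ← pathCost, ih, Nat.succ_mul, Finset.sum_range_add,
      dState_eq, dCost]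
    congr 1
    refine Finset.sum_congr rfl fun k hk => ?_
    rw [Finset.mem_range] at hk
    rw [rscState_symbol_block G σ u L hk.le, symbol_block G σ u L hk]

lemma dState_zero_eq (G : Gen p s) (u : ℕ → Inp p) (t : ℕ) :
    dState G 0 u t = (stateAt G 0 u t, rscState (symbol G 0 u) (t * s)) := dState_eq G 0 u t

lemma stepBits_sub (G : Gen p s) (σ σ' : JState G) (a b : Inp p) :
    stepBits G (σ - σ') (a - b) = stepBits G σ a - stepBits G σ' b := by
  funext n
  simp only [stepBits, outBit_sub, Pi.sub_apply]

lemma dStep_sub (G : Gen p s) (x y : DState G) (a b : Inp p) :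
    dStep G (x - y) (a - b) = dStep G x a - dStep G y b := by
  ext1
  · simp [dStep, nextState_sub]
  · simp only [dStep, Prod.fst_sub, Prod.snd_sub, stepBits_sub, rscState_sub]
    ring

lemma dState_sub (G : Gen p s) (x y : DState G) (u v : ℕ → Inp p) (t : ℕ) :
    dState G (x - y) (u - v) t = dState G x u t - dState G y v t := by
  induction t with
  | zero => rfl
  | succ t ih => simp only [dState, ih, Pi.sub_apply, dStep_sub]

lemma dStep_zero (G : Gen p s) : dStep G 0 0 = 0 := by
  simpa using dStep_sub G 0 0 0 0

lemma dState_add_steps (G : Gen p s) (x : DState G) (u : ℕ → Inp p) (a t : ℕ) :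
    dState G x u (a + t) = dState G (dState G x u a) (fun n => u (a + n)) t := by
  induction t with
  | zero => rfl
  | succ t ih => rw [← add_assoc, dState, ih, dState]

lemma pathCost_add_steps (G : Gen p s) (x : DState G) (u : ℕ → Inp p) (a t : ℕ) :
    pathCost G x u (a + t) =
      pathCost G x u a + pathCost G (dState G x u a) (fun n => u (a + n)) t := by
  simp only [pathCost, Finset.sum_range_add, dState_add_steps]

lemma dState_congr (G : Gen p s) (x : DState G) {u v : ℕ → Inp p} {t : ℕ}
    (h : ∀ i < t, u i = v i) : dState G x u t = dState G x v t := by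
  induction t with
  | zero => rfl
  | succ t ih => rw [dState, dState, ih fun i hi => h i (hi.trans t.lt_succ_self),
      h t t.lt_succ_self]

lemma pathCost_congr (G : Gen p s) (x : DState G) {u v : ℕ → Inp p} {t : ℕ}
    (h : ∀ i < t, u i = v i) : pathCost G x u t = pathCost G x v t := by
  refine Finset.sum_congr rfl fun i hi => ?_
  rw [Finset.mem_range] at hi
  rw [dState_congr G x fun j hj => h j (hj.trans hi), h i hi]

/-- Linearity reduces the product-state diagram to the difference system, independently of the start
state. -/
lemma isMerged_productState_iff (G : Gen p s) (σ : JState G) (u v : ℕ → Inp p) (t : ℕ) :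
    IsMerged (productState G σ u v t) ↔ dState G 0 (u - v) t = 0 := by
  have h1 := stateAt_sub G σ σ u v t
  have h2 := symbol_sub G σ σ u v
  rw [sub_self] at h1 h2
  rw [dState_zero_eq, h1, h2, rscState_sub, Prod.mk_eq_zero, sub_eq_zero]
  rfl

/-! ### Controllability -/

/-- The state of the difference system can be reached from the zero state. -/
def Reachable (G : Gen p s) (x : DState G) : Prop := ∃ u t, dState G 0 u t = x

lemma reachable_zero (G : Gen p s) : Reachable G 0 := ⟨0, 0, rfl⟩

lemma Reachable.dStep {G : Gen p s} {x : DState G} (hx : Reachable G x) (a : Inp p) :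
    Reachable G (dStep G x a) := by
  obtain ⟨u, t, rfl⟩ := hx
  refine ⟨fun n => if n < t then u n else a, t + 1, ?_⟩
  rw [dState, dState_congr G 0 (v := u) fun i hi => by simp [hi]]
  simp

lemma dState_zero_zero (G : Gen p s) (t : ℕ) : dState G 0 0 t = 0 := by
  simpa using dState_sub G 0 0 0 0 t

lemma dState_delay (G : Gen p s) (u : ℕ → Inp p) (a t : ℕ) :
    dState G 0 (fun n => if n < a then 0 else u (n - a)) (a + t) = dState G 0 u t := by
  rw [dState_add_steps, dState_congr G 0 (v := 0) fun i hi => by simp [hi], dState_zero_zero]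
  congr 1
  funext n
  simp

/-- Delaying inputs makes all of the finitely many reachable states reachable from 0 in one common
number `n` of steps. Zero input drives `x` to some reachable state in `n` steps; subtracting an
input that leads from 0 to that state in the same time ends at 0. -/
lemma Reachable.exists_dState_eq_zero {G : Gen p s} {x : DState G} (hx : Reachable G x) :
    ∃ u t, dState G x u t = 0 := by
  classical
  have hex : ∀ y : DState G, ∃ t, Reachable G y → ∃ u, dState G 0 u t = y := by
    intro y
    by_cases hy : Reachable G y
    · obtain ⟨u, t, h⟩ := hy
      exact ⟨t, fun _ => ⟨u, h⟩⟩
    · exact ⟨0, fun h => absurd h hy⟩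
  choose τ hτ using hex
  set n := Finset.univ.sup τ with hn
  have hall : ∀ y, Reachable G y → ∃ u, dState G 0 u n = y := by
    intro y hy
    obtain ⟨u, hu⟩ := hτ y hy
    have hle : τ y ≤ n := Finset.le_sup (Finset.mem_univ y)
    have h := dState_delay G u (n - τ y) (τ y)
    rw [Nat.sub_add_cancel hle, hu] at h
    exact ⟨_, h⟩
  have hreach : ∀ t, Reachable G (dState G x 0 t) := by
    intro t
    induction t with
    | zero => exact hx
    | succ t ih => exact ih.dStep _
  obtain ⟨v, hv⟩ := hall _ (hreach n)
  refine ⟨0 - v, n, ?_⟩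
  have h := dState_sub G x 0 0 v n
  rwa [sub_zero, hv, sub_self] at h

end DistCPFSK
end

noncomputable section

namespace DistCPFSK

variable {p s : ℕ}

/-! ### Distance of CPFSK signals -/

lemma measurable_phase (K : ℕ) (T : ℝ) (μ : ℕ → ZMod 2) : Measurable (phase K T μ) := by
  have hfl : Measurable fun t : ℝ => ⌊t / T⌋₊ := Nat.measurable_floor.comp (by fun_prop)
  have h1 : Measurable fun t : ℝ => ((rscState μ ⌊t / T⌋₊).val : ℝ) :=
    (Measurable.of_discrete (f := fun n : ℕ => ((rscState μ n).val : ℝ))).comp hfl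
  have h2 : Measurable fun t : ℝ => ((μ ⌊t / T⌋₊).val : ℝ) :=
    (Measurable.of_discrete (f := fun n : ℕ => ((μ n).val : ℝ))).comp hfl
  have h3 : Measurable fun t : ℝ => (⌊t / T⌋₊ : ℝ) :=
    (Measurable.of_discrete (f := fun n : ℕ => (n : ℝ))).comp hfl
  unfold phase phaseResponse
  fun_prop

/-- Unit-amplitude CPFSK signal of a symbol stream. -/
def cpfsk (K : ℕ) (T : ℝ) (μ : ℕ → ZMod 2) (t : ℝ) : ℂ :=
  Complex.exp (Complex.I * (phase K T μ t : ℂ))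

lemma measurable_cpfsk (K : ℕ) (T : ℝ) (μ : ℕ → ZMod 2) : Measurable (cpfsk K T μ) := by
  have := measurable_phase K T μ
  unfold cpfsk
  fun_prop

lemma norm_cpfsk (K : ℕ) (T : ℝ) (μ : ℕ → ZMod 2) (t : ℝ) : ‖cpfsk K T μ t‖ = 1 :=
  Complex.norm_exp_I_mul_ofReal _

lemma norm_exp_sub_exp_sq (α β : ℝ) :
    ‖Complex.exp (Complex.I * (α : ℂ)) - Complex.exp (Complex.I * (β : ℂ))‖ ^ 2 =
      2 - 2 * Real.cos (α - β) := by
  rw [← Complex.normSq_eq_norm_sq, mul_comm, mul_comm Complex.I, Complex.normSq_apply]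
  simp only [Complex.sub_re, Complex.sub_im, Complex.exp_ofReal_mul_I_re,
    Complex.exp_ofReal_mul_I_im, Real.cos_sub]
  nlinarith [Real.sin_sq_add_cos_sq α, Real.sin_sq_add_cos_sq β]

lemma floor_div_eq {T : ℝ} (hT : 0 < T) {n : ℕ} {t : ℝ} (h1 : n * T ≤ t) (h2 : t < (n + 1) * T) :
    ⌊t / T⌋₊ = n := by
  rw [Nat.floor_eq_iff (div_nonneg ((by positivity : (0 : ℝ) ≤ n * T).trans h1) hT.le)]
  exact ⟨(le_div_iff₀ hT).2 h1, (div_lt_iff₀ hT).2 h2⟩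

/-- The argument runs linearly between the integer multiples πKa and πK(a+b) of π, and the sine
vanishes at both ends. -/
lemma integral_cos_phase_eq_zero {K : ℕ} (hK : Odd K) {T : ℝ} (hT : 0 < T) (n : ℕ) {a b : ℤ}
    (hb : b ≠ 0) :
    ∫ t in (n * T : ℝ)..((n + 1) * T),
      Real.cos (Real.pi * K * b / T * t + Real.pi * K * (a - b * n)) = 0 := by
  have hK0 : (K : ℝ) ≠ 0 := by exact_mod_cast hK.pos.ne'
  have hb' : (b : ℝ) ≠ 0 := by exact_mod_cast hb
  rw [intervalIntegral.integral_comp_mul_add (fun x => Real.cos x)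
    (by have := Real.pi_ne_zero; positivity), integral_cos]
  have h1 : Real.pi * K * b / T * ((n + 1) * T) + Real.pi * K * (a - b * n) =
      ((K * (a + b) : ℤ) : ℝ) * Real.pi := by
    push_cast
    field_simp
    ring
  have h2 : Real.pi * K * b / T * (n * T) + Real.pi * K * (a - b * n) =
      ((K * a : ℤ) : ℝ) * Real.pi := by
    push_cast
    field_simp
    ring
  rw [h1, h2, Real.sin_int_mul_pi, Real.sin_int_mul_pi]
  simp

lemma zmod_two_val_sub_cases (x y : ZMod 2) :
    (x - y = 0 ∧ ((x.val : ℤ) - y.val) = 0) ∨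
      (x - y ≠ 0 ∧ (((x.val : ℤ) - y.val) = 1 ∨ ((x.val : ℤ) - y.val) = -1)) := by
  revert x y
  decide

/-- The squared distance is 2 - 2cos of the phase difference. For different symbols the cosine
integrates to 0. For equal symbols the phase difference is constant, either 0 or, since `K` is odd,
an odd multiple of π (antipodal signals). -/
lemma integral_cpfsk_symbol {K : ℕ} (hK : Odd K) {T : ℝ} (hT : 0 < T) (μ ν : ℕ → ZMod 2) (n : ℕ) :
    ∫ t in (n * T : ℝ)..((n + 1) * T), ‖cpfsk K T μ t - cpfsk K T ν t‖ ^ 2 =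
      2 * T * symCost (rscState μ n - rscState ν n) (μ n - ν n) := by
  set a : ℤ := ((rscState μ n).val : ℤ) - (rscState ν n).val with ha
  set b : ℤ := ((μ n).val : ℤ) - (ν n).val with hb
  have hle : (n * T : ℝ) ≤ (n + 1) * T := by nlinarith
  have hcongr : ∫ t in (n * T : ℝ)..((n + 1) * T), ‖cpfsk K T μ t - cpfsk K T ν t‖ ^ 2 =
      ∫ t in (n * T : ℝ)..((n + 1) * T),
        (2 - 2 * Real.cos (Real.pi * K * b / T * t + Real.pi * K * (a - b * n))) := by
    refine intervalIntegral.integral_congr_Ioo_of_le hle fun t ht => ?_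
    simp only [cpfsk]
    rw [norm_exp_sub_exp_sq, phase, phase, floor_div_eq hT ht.1.le ht.2]
    congr 3
    simp only [phaseResponse, ha, hb]
    push_cast
    field_simp
    ring
  rw [hcongr, intervalIntegral.integral_sub (by simp)
    (Continuous.intervalIntegrable (by fun_prop) _ _), intervalIntegral.integral_const_mul]
  simp only [intervalIntegral.integral_const, smul_eq_mul]
  rcases zmod_two_val_sub_cases (μ n) (ν n) with ⟨h0, hb0⟩ | ⟨h0, hb0⟩
  · rw [← hb] at hb0
    simp only [hb0, symCost, h0, Int.cast_zero, mul_zero, zero_div, zero_mul, zero_add, sub_zero,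
      intervalIntegral.integral_const, smul_eq_mul, ne_eq, not_true_eq_false, if_false]
    have hodd : Real.cos (Real.pi * K) = -1 := by
      obtain ⟨m, rfl⟩ := hK
      rw [show Real.pi * ((2 * m + 1 : ℕ) : ℝ) = m * (2 * Real.pi) + Real.pi by push_cast; ring,
        Real.cos_nat_mul_two_pi_add_pi]
    rcases zmod_two_val_sub_cases (rscState μ n) (rscState ν n) with ⟨h1, ha0⟩ | ⟨h1, ha0⟩
    · rw [← ha] at ha0
      simp only [ha0, h1]
      simp
      ring
    · have hcos : Real.cos (Real.pi * K * a) = -1 := by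
        rcases ha0 with h | h <;> rw [← ha] at h <;> simp [h, hodd]
      rw [hcos, if_pos h1]
      push_cast
      ring
  · have hb1 : b ≠ 0 := by rw [← hb] at hb0; omega
    rw [integral_cos_phase_eq_zero hK hT n hb1, symCost, if_pos h0]
    push_cast
    ring

lemma intervalIntegrable_cpfsk_sub (K : ℕ) (T : ℝ) (μ ν : ℕ → ZMod 2) (a b : ℝ) :
    IntervalIntegrable (fun t => ‖cpfsk K T μ t - cpfsk K T ν t‖ ^ 2) volume a b := by
  rw [intervalIntegrable_iff]
  have : IsFiniteMeasure (volume.restrict (Set.uIoc a b)) := by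
    rw [Set.uIoc]; infer_instance
  have h1 := measurable_cpfsk K T μ
  have h2 := measurable_cpfsk K T ν
  refine Integrable.of_bound (by fun_prop) (2 ^ 2) (Eventually.of_forall fun t => ?_)
  rw [Real.norm_of_nonneg (by positivity)]
  gcongr
  calc ‖cpfsk K T μ t - cpfsk K T ν t‖ ≤ ‖cpfsk K T μ t‖ + ‖cpfsk K T ν t‖ := norm_sub_le _ _
    _ = 2 := by rw [norm_cpfsk, norm_cpfsk]; norm_num

lemma integral_cpfsk {K : ℕ} (hK : Odd K) {T : ℝ} (hT : 0 < T) (μ ν : ℕ → ZMod 2) (n : ℕ) :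
    ∫ t in (0 : ℝ)..(n * T), ‖cpfsk K T μ t - cpfsk K T ν t‖ ^ 2 =
      2 * T * ∑ i ∈ Finset.range n, (symCost (rscState (μ - ν) i) ((μ - ν) i) : ℝ) := by
  have h := intervalIntegral.sum_integral_adjacent_intervals (a := fun n : ℕ => (n * T : ℝ)) (n := n)
    (f := fun t => ‖cpfsk K T μ t - cpfsk K T ν t‖ ^ 2)
    (fun k _ => intervalIntegrable_cpfsk_sub K T μ ν _ _)
  simp only [Nat.cast_zero, zero_mul] at h
  rw [← h, Finset.mul_sum]
  refine Finset.sum_congr rfl fun i _ => ?_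
  rw [rscState_sub, Pi.sub_apply, ← integral_cpfsk_symbol hK hT]
  push_cast
  rfl

variable [NeZero s]

lemma integral_envelope (G : Gen p s) {K : ℕ} (hK : Odd K) {T : ℝ} (hT : 0 < T) (σ : JState G)
    (u v : ℕ → Inp p) (L : ℕ) :
    ∫ t in (0 : ℝ)..(L * s * T), ‖envelope G K T σ u t - envelope G K T σ v t‖ ^ 2 =
      2 * T * pathCost G 0 (u - v) L := by
  have h1 := symbol_sub G σ σ u v
  rw [sub_self] at h1
  have h := integral_cpfsk hK hT (symbol G σ u) (symbol G σ v) (L * s)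
  rw [← h1] at h
  have h0 := pathCost_eq G 0 (u - v) L
  rw [show ((0 : JState G), (0 : ZMod 2)) = 0 from rfl] at h0
  rw [h0]
  push_cast at h ⊢
  exact h

lemma ErrorEvent.nsed_eq {G : Gen p s} (e : ErrorEvent G) {K : ℕ} (hK : Odd K) {T : ℝ}
    (hT : 0 < T) : e.nsed K T = pathCost G 0 (extend (e.sent - e.decoded)) e.len := by
  rw [ErrorEvent.nsed, integral_envelope G hK hT, extend_sub]
  field_simp

/-! ### Correlation of signals -/

lemma integrable_corr {f g : ℝ → ℂ} (hf : MemLp f 2) (hg : MemLp g 2) :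
    Integrable fun t => ((starRingEnd ℂ) (f t) * g t).re :=
  (MemLp.integrable_mul hf.star hg).re

lemma corr_comm (f g : ℝ → ℂ) : corr f g = corr g f := by
  unfold corr
  congr 1
  ext t
  simp
  ring

lemma corr_sub_right {f g h : ℝ → ℂ} (hf : MemLp f 2) (hg : MemLp g 2) (hh : MemLp h 2) :
    corr f (g - h) = corr f g - corr f h := by
  unfold corr
  rw [← integral_sub (integrable_corr hf hg) (integrable_corr hf hh)]
  congr 1
  ext t
  simp
  ring

lemma corr_sub_left {f g h : ℝ → ℂ} (hf : MemLp f 2) (hg : MemLp g 2) (hh : MemLp h 2) :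
    corr (f - g) h = corr f h - corr g h := by
  rw [corr_comm, corr_sub_right hh hf hg, corr_comm h, corr_comm h]

lemma corr_self (f : ℝ → ℂ) : corr f f = ∫ t, ‖f t‖ ^ 2 := by
  unfold corr
  congr 1
  ext t
  rw [mul_comm, Complex.mul_conj, Complex.ofReal_re, Complex.normSq_eq_norm_sq]

lemma memLp_signal (G : Gen p s) (K : ℕ) (T Es : ℝ) {N : ℕ} (u : Msg p N) :
    MemLp (signal G K T Es u) 2 := by
  unfold signal
  rw [memLp_indicator_iff_restrict measurableSet_Ico]
  refine MemLp.of_bound (((measurable_cpfsk K T (symbol G 0 (extend u))).const_mul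
    _).aestronglyMeasurable) (√(2 * Es / T)) (Eventually.of_forall fun t => ?_)
  rw [norm_mul, show ‖envelope G K T 0 (extend u) t‖ = 1 from norm_cpfsk _ _ _ _, mul_one,
    Complex.norm_real, Real.norm_of_nonneg (Real.sqrt_nonneg _)]

/-- The constant envelope gives all blocks equal energy, so the detector only compares correlator
outputs. -/
lemma corr_signal_self (G : Gen p s) (K : ℕ) (T Es : ℝ) {N : ℕ} (u v : Msg p N) :
    corr (signal G K T Es u) (signal G K T Es u) = corr (signal G K T Es v) (signal G K T Es v) := by
  rw [corr_self, corr_self]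
  congr 1
  ext t
  unfold signal Set.indicator
  split_ifs
  · rw [norm_mul, norm_mul, show ‖envelope G K T 0 (extend u) t‖ = 1 from norm_cpfsk _ _ _ _,
      show ‖envelope G K T 0 (extend v) t‖ = 1 from norm_cpfsk _ _ _ _]
  · rfl

lemma corr_signal_sub (G : Gen p s) {K : ℕ} (hK : Odd K) {T Es : ℝ} (hT : 0 < T) (hEs : 0 < Es)
    {N : ℕ} (u v : Msg p N) :
    corr (signal G K T Es u - signal G K T Es v) (signal G K T Es u - signal G K T Es v) =
      4 * Es * pathCost G 0 (extend u - extend v) N := by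
  have h := integral_envelope G hK hT 0 (extend u) (extend v) N
  have hle : (0 : ℝ) ≤ N * s * T := by positivity
  rw [intervalIntegral.integral_of_le hle, ← integral_Ico_eq_integral_Ioc] at h
  have hpt : ∀ t, ‖(signal G K T Es u - signal G K T Es v) t‖ ^ 2 =
      (Set.Ico (0 : ℝ) (N * s * T)).indicator (fun t => 2 * Es / T *
        ‖envelope G K T 0 (extend u) t - envelope G K T 0 (extend v) t‖ ^ 2) t := by
    intro t
    rw [Pi.sub_apply]
    unfold signal Set.indicator
    split_ifs
    · rw [← mul_sub, norm_mul, mul_pow, Complex.norm_real, Real.norm_of_nonneg (Real.sqrt_nonneg _),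
        Real.sq_sqrt (by positivity)]
    · simp
  rw [corr_self]
  simp only [hpt]
  rw [integral_indicator measurableSet_Ico, integral_const_mul, h]
  field_simp
  ring

end DistCPFSK
end

noncomputable section

namespace DistCPFSK

variable {p s : ℕ}

/-! ### White noise -/

section WhiteNoise

variable {Ω : Type*} [MeasurableSpace Ω] {P : Measure Ω} {N0 : ℝ}
  {Z : (ℝ → ℂ) → Ω → ℝ} (hZ : IsWhiteNoise P N0 Z) {f g f' g' : ℝ → ℂ}
include hZ

lemma IsWhiteNoise.memLp (hf : MemLp f 2) : MemLp (Z f) 2 P :=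
  (hZ.gaussian.hasGaussianLaw_eval ⟨f, hf⟩).memLp_two

lemma IsWhiteNoise.hasGaussianLaw_sub (hf : MemLp f 2) (hg : MemLp g 2) :
    HasGaussianLaw (Z f - Z g) P :=
  hZ.gaussian.hasGaussianLaw_sub (s := ⟨f, hf⟩) (t := ⟨g, hg⟩)

variable [IsProbabilityMeasure P]

lemma IsWhiteNoise.integral_sub (hf : MemLp f 2) (hg : MemLp g 2) :
    ∫ ω, (Z f - Z g) ω ∂P = 0 := by
  simp only [Pi.sub_apply]
  rw [MeasureTheory.integral_sub ((hZ.memLp hf).integrable (by norm_num))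
    ((hZ.memLp hg).integrable (by norm_num)), hZ.mean f hf, hZ.mean g hg, sub_zero]

lemma IsWhiteNoise.covariance_sub (hf : MemLp f 2) (hg : MemLp g 2) (hf' : MemLp f' 2)
    (hg' : MemLp g' 2) : cov[Z f - Z g, Z f' - Z g'; P] = N0 * corr (f - g) (f' - g') := by
  rw [covariance_sub_sub (hZ.memLp hf) (hZ.memLp hg) (hZ.memLp hf') (hZ.memLp hg'),
    hZ.covariance _ _ hf hf', hZ.covariance _ _ hf hg', hZ.covariance _ _ hg hf',
    hZ.covariance _ _ hg hg', corr_sub_left hf hg (hf'.sub hg'), corr_sub_right hf hf' hg',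
    corr_sub_right hg hf' hg']
  ring

lemma IsWhiteNoise.variance_sub (hf : MemLp f 2) (hg : MemLp g 2) :
    Var[Z f - Z g; P] = N0 * corr (f - g) (f - g) := by
  rw [← covariance_self (hZ.hasGaussianLaw_sub hf hg).aemeasurable, hZ.covariance_sub hf hg hf hg]

/-- `Z` is not assumed linear. The covariance gives the discrepancy variance 0, and its mean is 0,
so linearity holds almost surely for each fixed choice of functions. -/
lemma IsWhiteNoise.sub_ae_eq (hf : MemLp f 2) (hg : MemLp g 2) (hf' : MemLp f' 2)
    (hg' : MemLp g' 2) (h : f - g = f' - g') : ∀ᵐ ω ∂P, Z f ω - Z g ω = Z f' ω - Z g' ω := by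
  have h1 := (hZ.memLp hf).sub (hZ.memLp hg)
  have h2 := (hZ.memLp hf').sub (hZ.memLp hg')
  have hvar : Var[(Z f - Z g) - (Z f' - Z g'); P] = 0 := by
    rw [ProbabilityTheory.variance_sub h1 h2, hZ.variance_sub hf hg, hZ.variance_sub hf' hg',
      hZ.covariance_sub hf hg hf' hg', h]
    ring
  have hmean : ∫ ω, ((Z f - Z g) - (Z f' - Z g')) ω ∂P = 0 := by
    simp only [Pi.sub_apply (Z f - Z g)]
    rw [MeasureTheory.integral_sub (h1.integrable (by norm_num)) (h2.integrable (by norm_num)),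
      hZ.integral_sub hf hg, hZ.integral_sub hf' hg', sub_zero]
  filter_upwards [ae_eq_integral_of_variance_eq_zero (h1.sub h2) hvar] with ω hω
  rw [hmean] at hω
  simpa [sub_eq_zero] using hω

lemma IsWhiteNoise.measureReal_le (hf : MemLp f 2) (hg : MemLp g 2)
    (hpos : 0 < N0 * corr (f - g) (f - g)) (t : ℝ) :
    P.real {ω | t ≤ Z f ω - Z g ω} = gaussQ (t / √(N0 * corr (f - g) (f - g))) := by
  have hlaw := hZ.hasGaussianLaw_sub hf hg
  have hmap := hlaw.map_eq_gaussianReal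
  rw [hZ.integral_sub hf hg, hZ.variance_sub hf hg] at hmap
  have h := gaussianReal_Ici (v := (N0 * corr (f - g) (f - g)).toNNReal)
    (by simpa using hpos) t
  rw [← hmap, Real.coe_toNNReal _ hpos.le,
    map_measureReal_apply_of_aemeasurable hlaw.aemeasurable measurableSet_Ici] at h
  exact h

end WhiteNoise

variable [NeZero s]

/-- Pairwise error probability. -/
lemma measureReal_pairwise_error {Ω : Type*} [MeasurableSpace Ω] {P : Measure Ω}
    [IsProbabilityMeasure P] {N0 : ℝ} {Z : (ℝ → ℂ) → Ω → ℝ} (hZ : IsWhiteNoise P N0 Z)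
    (hN0 : 0 < N0) (G : Gen p s) {K : ℕ} (hK : Odd K) {T Es : ℝ} (hT : 0 < T) (hEs : 0 < Es)
    {N : ℕ} (u z : Msg p N) (hD : pathCost G 0 (extend z - extend u) N ≠ 0) :
    P.real {ω | received G K T Es Z u ω u ≤ received G K T Es Z u ω z} =
      gaussQ (√(pathCost G 0 (extend z - extend u) N * (Es / N0))) := by
  have hz := memLp_signal G K T Es z
  have hu := memLp_signal G K T Es u
  have hc := corr_signal_sub G hK hT hEs z u
  have hD' : (0 : ℝ) < pathCost G 0 (extend z - extend u) N := by positivity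
  set D : ℝ := ((pathCost G 0 (extend z - extend u) N : ℕ) : ℝ)
  have hexp := hc
  rw [corr_sub_left hz hu (hz.sub hu), corr_sub_right hz hz hu, corr_sub_right hu hz hu,
    corr_signal_self G K T Es z u, corr_comm (signal G K T Es z)] at hexp
  have hset : {ω | received G K T Es Z u ω u ≤ received G K T Es Z u ω z} =
      {ω | 2 * Es * D ≤ Z (signal G K T Es z) ω - Z (signal G K T Es u) ω} := by
    ext ω
    simp only [received, Set.mem_ofPred_eq]
    constructor <;> intro h <;> linarith
  rw [hset, hZ.measureReal_le hz hu (by rw [hc]; positivity), hc]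
  congr 1
  -- The threshold is 2 Es D and the noise variance 4 N0 Es D; their normalized ratio is √(D Es/N0).
  rw [show N0 * (4 * Es * D) = (2 * Es * D) ^ 2 / (D * (Es / N0)) by field_simp; norm_num,
    Real.sqrt_div (by positivity), Real.sqrt_sq (by positivity)]
  have : √(D * (Es / N0)) ≠ 0 := (Real.sqrt_pos.2 (by positivity)).ne'
  field_simp

end DistCPFSK
end

noncomputable section

namespace DistCPFSK

variable {p s : ℕ}

/-! ### Words of the difference system -/

lemma extend_cons_zero {L : ℕ} (a : Inp p) (w : Msg p L) :
    extend (Fin.cons a w : Msg p (L + 1)) 0 = a := by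
  simp [extend]

lemma extend_cons_succ {L : ℕ} (a : Inp p) (w : Msg p L) (t : ℕ) :
    extend (Fin.cons a w : Msg p (L + 1)) (t + 1) = extend w t := by
  simp only [extend, Nat.add_lt_add_iff_right]
  split_ifs with h
  · exact Fin.cons_succ (α := fun _ => Inp p) a w ⟨t, h⟩
  · rfl

lemma sum_msg_succ {M : Type*} [AddCommMonoid M] {L : ℕ} (f : Msg p (L + 1) → M) :
    ∑ w, f w = ∑ a : Inp p, ∑ w : Msg p L, f (Fin.cons a w) := by
  rw [← Fintype.sum_prod_type' (fun (a : Inp p) (w : Msg p L) => f (Fin.cons a w))]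
  exact (Fintype.sum_equiv (Fin.consEquiv fun _ => Inp p) _ _ fun _ => rfl).symm

variable [NeZero s]

/-- The difference of the two paths of an error event. -/
def IsEvent (G : Gen p s) {L : ℕ} (w : Msg p L) : Prop :=
  0 < L ∧ extend w 0 ≠ 0 ∧ (∀ t, 0 < t → t < L → dState G 0 (extend w) t ≠ 0) ∧
    dState G 0 (extend w) L = 0

/-- The trajectory from `x` with input word `w` avoids the zero state at all positive times. -/
def AvoidsZero (G : Gen p s) (x : DState G) {L : ℕ} (w : Msg p L) : Prop :=
  ∀ t, 0 < t → t ≤ L → dState G x (extend w) t ≠ 0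

/-- The trajectory from `x` with input word `w` hits the zero state at the end of `w` and at no
earlier positive time. -/
def HitsZero (G : Gen p s) (x : DState G) {L : ℕ} (w : Msg p L) : Prop :=
  (∀ t, 0 < t → t < L → dState G x (extend w) t ≠ 0) ∧ dState G x (extend w) L = 0

/-- The words of error events. -/
abbrev EventWord (G : Gen p s) : Type := Σ L, {w : Msg p L // IsEvent G w}

lemma dState_succ' (G : Gen p s) (x : DState G) (u : ℕ → Inp p) (t : ℕ) :
    dState G x u (t + 1) = dState G (dStep G x (u 0)) (fun n => u (n + 1)) t := by
  rw [add_comm, dState_add_steps]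
  simp only [dState, add_comm]

lemma pathCost_succ' (G : Gen p s) (x : DState G) (u : ℕ → Inp p) (t : ℕ) :
    pathCost G x u (t + 1) =
      dCost G x (u 0) + pathCost G (dStep G x (u 0)) (fun n => u (n + 1)) t := by
  rw [add_comm, pathCost_add_steps]
  simp [pathCost, dState, add_comm]

lemma dState_cons (G : Gen p s) (x : DState G) {L : ℕ} (a : Inp p) (w : Msg p L) (t : ℕ) :
    dState G x (extend (Fin.cons a w : Msg p (L + 1))) (t + 1) =
      dState G (dStep G x a) (extend w) t := by
  rw [dState_succ']
  simp only [extend_cons_zero, extend_cons_succ]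

lemma pathCost_cons (G : Gen p s) (x : DState G) {L : ℕ} (a : Inp p) (w : Msg p L) (t : ℕ) :
    pathCost G x (extend (Fin.cons a w : Msg p (L + 1))) (t + 1) =
      dCost G x a + pathCost G (dStep G x a) (extend w) t := by
  rw [pathCost_succ']
  simp only [extend_cons_zero, extend_cons_succ]

lemma avoidsZero_cons {G : Gen p s} {x : DState G} {L : ℕ} {a : Inp p} {w : Msg p L} :
    AvoidsZero G x (Fin.cons a w : Msg p (L + 1)) ↔
      dStep G x a ≠ 0 ∧ AvoidsZero G (dStep G x a) w := by
  constructor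
  · intro h
    refine ⟨?_, fun t ht htL => ?_⟩
    · have := h 1 one_pos (by omega)
      rwa [dState_cons] at this
    · have := h (t + 1) (by omega) (by omega)
      rwa [dState_cons] at this
  · rintro ⟨h0, h⟩ t ht htL
    obtain ⟨t, rfl⟩ := Nat.exists_eq_succ_of_ne_zero ht.ne'
    rw [Nat.succ_eq_add_one, dState_cons]
    rcases Nat.eq_zero_or_pos t with rfl | h1
    · exact h0
    · exact h t h1 (by omega)

/-- The tail must be nonempty: for an empty tail the first step is itself the hit. -/
lemma hitsZero_cons {G : Gen p s} {x : DState G} {L : ℕ} {a : Inp p} {w : Msg p (L + 1)} :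
    HitsZero G x (Fin.cons a w : Msg p (L + 2)) ↔
      dStep G x a ≠ 0 ∧ HitsZero G (dStep G x a) w := by
  constructor
  · rintro ⟨h, h2⟩
    refine ⟨?_, fun t ht htL => ?_, ?_⟩
    · have := h 1 one_pos (by omega)
      rwa [dState_cons] at this
    · have := h (t + 1) (by omega) (by omega)
      rwa [dState_cons] at this
    · rwa [dState_cons] at h2
  · rintro ⟨h0, h, h2⟩
    refine ⟨fun t ht htL => ?_, by rwa [dState_cons]⟩
    obtain ⟨t, rfl⟩ := Nat.exists_eq_succ_of_ne_zero ht.ne'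
    rw [Nat.succ_eq_add_one, dState_cons]
    rcases Nat.eq_zero_or_pos t with rfl | h1
    · exact h0
    · exact h t h1 (by omega)

/-! ### Word sums as powers of the transition operator, and their decay. -/

section Weights

open scoped ENNReal

variable (G : Gen p s) (ζ : ℝ≥0∞)

/-- The weighted transition operator of the difference system without the transitions into the
zero state. -/
abbrev diffOp : Module.End ℝ≥0∞ (DState G → ℝ≥0∞) :=
  avoidOp (dStep G) (fun x a => ζ ^ dCost G x a) 0

/-- The total weight of the transitions of the difference system into the zero state. -/
abbrev diffHit : DState G → ℝ≥0∞ := hitWeight (dStep G) (fun x a => ζ ^ dCost G x a) 0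

lemma diffHit_apply (x : DState G) :
    diffHit G ζ x = ∑ a, if dStep G x a = 0 then ζ ^ dCost G x a else 0 :=
  (hitWeight_apply x).trans (Finset.sum_congr rfl fun a _ => by congr)

open Classical in
lemma diffOp_pow_one (n : ℕ) (x : DState G) :
    (diffOp G ζ ^ n) 1 x =
      ∑ w : Msg p n, if AvoidsZero G x w then ζ ^ pathCost G x (extend w) n else 0 := by
  induction n generalizing x with
  | zero =>
    have h : ∀ w : Msg p 0, AvoidsZero G x w := fun w t h1 h2 => by omega
    rw [Fintype.sum_unique, if_pos (h _)]
    simp [pathCost]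
  | succ n ih =>
    rw [pow_succ', Module.End.mul_apply, avoidOp_apply, sum_msg_succ]
    refine Finset.sum_congr rfl fun a _ => ?_
    simp only [avoidsZero_cons, pathCost_cons, ih]
    split_ifs with h
    · simp [h]
    · rw [Finset.mul_sum]
      refine Finset.sum_congr rfl fun w _ => ?_
      simp [h, pow_add]

open Classical in
lemma diffOp_pow_hit (n : ℕ) (x : DState G) :
    (diffOp G ζ ^ n) (diffHit G ζ) x =
      ∑ w : Msg p (n + 1), if HitsZero G x w then ζ ^ pathCost G x (extend w) (n + 1) else 0 := by
  induction n generalizing x with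
  | zero =>
    rw [sum_msg_succ, pow_zero, Module.End.one_apply, diffHit_apply]
    refine Finset.sum_congr rfl fun a _ => ?_
    rw [Fintype.sum_unique]
    have : ∀ w : Msg p 0, HitsZero G x (Fin.cons a w : Msg p (0 + 1)) ↔ dStep G x a = 0 := by
      intro w
      rw [HitsZero, dState_cons]
      exact ⟨fun h => h.2, fun h => ⟨fun t h1 h2 => by omega, h⟩⟩
    simp only [this, pathCost_cons]
    simp [pathCost]
  | succ n ih =>
    rw [pow_succ', Module.End.mul_apply, avoidOp_apply, sum_msg_succ]
    refine Finset.sum_congr rfl fun a _ => ?_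
    simp only [hitsZero_cons, pathCost_cons, ih]
    split_ifs with h
    · simp [h]
    · rw [Finset.mul_sum]
      refine Finset.sum_congr rfl fun w _ => ?_
      simp [h, pow_add]

variable {G ζ}

/-- A shortest input leading from `x` to 0 in a positive number of steps is a first passage of
positive weight. One step is taken before steering so that `x = 0` is covered as well. -/
lemma tsum_diffOp_hit_ne_zero (hζ : ζ ≠ 0) {x : DState G} (hx : Reachable G x) :
    ∑' n, (diffOp G ζ ^ n) (diffHit G ζ) x ≠ 0 := by
  classical
  have hex : ∃ n, ∃ u, dState G x u (n + 1) = 0 := by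
    obtain ⟨u, t, h⟩ := (hx.dStep 0).exists_dState_eq_zero
    refine ⟨t, fun n => if n = 0 then 0 else u (n - 1), ?_⟩
    rw [dState_succ']
    simpa using h
  obtain ⟨u, hu⟩ := Nat.find_spec hex
  set n := Nat.find hex with hn
  intro h0
  rw [ENNReal.tsum_eq_zero] at h0
  have h1 := h0 n
  rw [diffOp_pow_hit, Finset.sum_eq_zero_iff] at h1
  set w : Msg p (n + 1) := fun i => u i with hw
  have hwu : ∀ t ≤ n + 1, dState G x (extend w) t = dState G x u t := fun t ht =>
    dState_congr G x fun i hi => by rw [extend_of_lt w (hi.trans_le ht)]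
  have hhit : HitsZero G x w := by
    refine ⟨fun t ht htn h => ?_, by rw [hwu _ le_rfl, hu]⟩
    obtain ⟨t, rfl⟩ := Nat.exists_eq_succ_of_ne_zero ht.ne'
    exact Nat.find_min hex (m := t) (by omega) ⟨_, h⟩
  have h2 := h1 w (Finset.mem_univ _)
  rw [if_pos hhit] at h2
  exact pow_ne_zero _ hζ h2

lemma tsum_diffOp_hit_eq (x : DState G) :
    ∑' n, (diffOp G ζ ^ n) (diffHit G ζ) x =
      diffHit G ζ x + diffOp G ζ (fun y => ∑' n, (diffOp G ζ ^ n) (diffHit G ζ) y) x := by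
  rw [avoidOp_tsum, tsum_eq_zero_add' ENNReal.summable]
  simp only [pow_zero, Module.End.one_apply, pow_succ', Module.End.mul_apply]

/-- Finiteness propagates from 0 along trajectories: every transition has positive weight, so an
infinite value at a nonzero successor would make the value at the predecessor infinite. -/
lemma tsum_diffOp_hit_ne_top (hζ : ζ ≠ 0)
    (h0 : ∑' n, (diffOp G ζ ^ n) (diffHit G ζ) 0 ≠ ∞) {x : DState G} (hx : Reachable G x) :
    ∑' n, (diffOp G ζ ^ n) (diffHit G ζ) x ≠ ∞ := by
  classical
  obtain ⟨u, t, rfl⟩ := hx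
  induction t with
  | zero => exact h0
  | succ t ih =>
    rw [dState]
    set y := dState G 0 u t
    by_cases hy : dStep G y (u t) = 0
    · rwa [hy]
    · intro htop
      rw [tsum_diffOp_hit_eq y] at ih
      refine ih (ENNReal.add_eq_top.2 (Or.inr ?_))
      rw [avoidOp_apply, ENNReal.sum_eq_top]
      refine ⟨u t, Finset.mem_univ _, ?_⟩
      rw [if_neg hy, htop, ENNReal.mul_top (pow_ne_zero _ hζ)]

lemma tsum_eventWord (f : (L : ℕ) → Msg p L → ℝ≥0∞) :
    ∑' e : EventWord G, f e.1 e.2.1 =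
      ∑' L, ∑ w : Msg p L, open Classical in if IsEvent G w then f L w else 0 := by
  classical
  rw [ENNReal.tsum_sigma (fun L (w : {w : Msg p L // IsEvent G w}) => f L w.1)]
  refine tsum_congr fun L => ?_
  rw [tsum_fintype, ← Finset.sum_filter]
  exact (Finset.sum_subtype _ (by simp) _).symm

lemma tsum_diffOp_hit_zero_ne_top (hζ : ζ ≠ ∞)
    (h : ∑' e : EventWord G, ζ ^ pathCost G 0 (extend e.2.1) e.1 ≠ ∞) :
    ∑' n, (diffOp G ζ ^ n) (diffHit G ζ) 0 ≠ ∞ := by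
  classical
  -- First passages from 0 of at least two steps are error events. Those of one step include the
  -- self-loop with zero input, which is no event; the finite extra term for `n = 0` absorbs it.
  have hle : ∀ n, (diffOp G ζ ^ n) (diffHit G ζ) 0 ≤
      (if n = 0 then ∑ w : Msg p (n + 1), ζ ^ pathCost G 0 (extend w) (n + 1) else 0) +
        ∑ w : Msg p (n + 1),
          if IsEvent G w then ζ ^ pathCost G 0 (extend w) (n + 1) else 0 := by
    intro n
    rw [diffOp_pow_hit]
    split_ifs with hn
    · refine le_add_right (Finset.sum_le_sum fun w _ => ?_)
      split_ifs <;> simp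
    · rw [zero_add]
      refine Finset.sum_le_sum fun w _ => ?_
      by_cases hw : HitsZero G 0 w
      · have : IsEvent G w := by
          refine ⟨by omega, fun h0 => ?_, hw⟩
          refine hw.1 1 one_pos (by omega) ?_
          rw [dState, h0]
          exact dStep_zero G
        rw [if_pos hw, if_pos this]
      · rw [if_neg hw]
        exact zero_le
  refine ne_top_of_le_ne_top ?_ (ENNReal.tsum_le_tsum hle)
  rw [ENNReal.tsum_add]
  refine ENNReal.add_ne_top.2 ⟨?_, ?_⟩
  · rw [tsum_eq_single 0 fun n hn => if_neg hn, if_pos rfl, ENNReal.sum_ne_top]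
    exact fun w _ => ENNReal.pow_ne_top hζ
  · rw [tsum_eventWord (fun L w => ζ ^ pathCost G 0 (extend w) L)] at h
    refine ne_top_of_le_ne_top h ?_
    exact ENNReal.tsum_comp_le_tsum_of_injective (add_left_injective 1)
      (fun L => ∑ w : Msg p L, if IsEvent G w then ζ ^ pathCost G 0 (extend w) L else 0)

/-- If the total weight of the error events is finite, then the total weight of the error events
and of the unterminated paths of a given length decays exponentially with the length. -/
theorem exists_word_weight_decay (hζ0 : ζ ≠ 0) (hζ : ζ ≠ ∞)
    (h : ∑' e : EventWord G, ζ ^ pathCost G 0 (extend e.2.1) e.1 ≠ ∞) :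
    ∃ ρ C : ℝ≥0∞, ρ < 1 ∧ C ≠ ∞ ∧ ∀ n,
      (∑ w : Msg p n, open Classical in
        if AvoidsZero G 0 w then ζ ^ pathCost G 0 (extend w) n else 0) ≤ C * ρ ^ n ∧
      (∑ w : Msg p (n + 1), open Classical in
        if IsEvent G w then ζ ^ pathCost G 0 (extend w) (n + 1) else 0) ≤ C * ρ ^ n := by
  classical
  obtain ⟨ρ, C, hρ, hC, hdec⟩ := avoidOp_exponential_decay (R := Reachable G)
    (fun x a hx => hx.dStep a)
    (fun x hx => tsum_diffOp_hit_ne_top hζ0 (tsum_diffOp_hit_zero_ne_top hζ h) hx)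
    (fun x hx => tsum_diffOp_hit_ne_zero hζ0 hx)
  -- Since `diffHit ≤ B • 1`, event weights inherit the decay of the avoiding paths.
  set B : ℝ≥0∞ := ∑ x, diffHit G ζ x with hB
  have hBfin : B ≠ ∞ := by
    rw [hB, ENNReal.sum_ne_top]
    intro x _
    rw [diffHit_apply, ENNReal.sum_ne_top]
    intro a _
    split_ifs
    · exact ENNReal.pow_ne_top hζ
    · simp
  refine ⟨ρ, (1 + B) * C, hρ, ENNReal.mul_ne_top (by simp [hBfin]) hC, fun n => ⟨?_, ?_⟩⟩
  · rw [← diffOp_pow_one]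
    refine (hdec n 0 (reachable_zero G)).trans ?_
    gcongr
    exact le_mul_of_one_le_left zero_le le_self_add
  · have h1 : (∑ w : Msg p (n + 1),
        if IsEvent G w then ζ ^ pathCost G 0 (extend w) (n + 1) else 0) ≤
        (diffOp G ζ ^ n) (diffHit G ζ) 0 := by
      rw [diffOp_pow_hit]
      refine Finset.sum_le_sum fun w _ => ?_
      by_cases hw : IsEvent G w
      · have hw' : HitsZero G 0 w := hw.2.2
        rw [if_pos hw, if_pos hw']
      · rw [if_neg hw]
        exact zero_le
    have h2 : (diffOp G ζ ^ n) (diffHit G ζ) 0 ≤ (diffOp G ζ ^ n) (B • 1) 0 := by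
      refine avoidOp_pow_mono (R := Reachable G) (fun x a hx => hx.dStep a) (fun x _ => ?_) n
        (reachable_zero G)
      simp only [Pi.smul_apply, Pi.one_apply, smul_eq_mul, mul_one]
      exact Finset.single_le_sum (f := diffHit G ζ) (fun _ _ => zero_le) (Finset.mem_univ x)
    refine h1.trans (h2.trans ?_)
    rw [map_smul, Pi.smul_apply, smul_eq_mul, mul_assoc]
    exact mul_le_mul' le_add_self (hdec n 0 (reachable_zero G))

end Weights

end DistCPFSK
end

noncomputable section

namespace DistCPFSK

variable {p s : ℕ}

/-! ### The transfer function -/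

lemma bitErrors_sub {N : ℕ} (u v : Msg p N) : bitErrors u v = bitErrors (u - v) 0 := by
  simp [bitErrors, sub_eq_zero]

lemma bitErrors_le {N : ℕ} (u v : Msg p N) : bitErrors u v ≤ p * N := by
  refine (Finset.card_filter_le _ _).trans ?_
  simp [mul_comm]

/-- Finite fibers are essential, since `Nat.card` of an infinite type is 0. -/
lemma tsum_card_fiber {A X : Type*} (g : A → X) (hfin : ∀ x, Finite {a // g a = x})
    (F : X → ENNReal) :
    ∑' x, (Nat.card {a // g a = x} : ENNReal) * F x = ∑' a, F (g a) := by
  rw [← (Equiv.sigmaFiberEquiv g).tsum_eq, ENNReal.tsum_sigma']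
  refine tsum_congr fun x => ?_
  have := Fintype.ofFinite {a // g a = x}
  rw [tsum_fintype, Nat.card_eq_fintype_card]
  rw [Finset.sum_congr rfl fun a _ => show F (g (Equiv.sigmaFiberEquiv g ⟨x, a⟩)) = F x by
    rw [Equiv.sigmaFiberEquiv_apply]; exact congrArg F a.2]
  simp

lemma card_jState (G : Gen p s) : Fintype.card (JState G) = 2 ^ memory G := by
  rw [Fintype.card_pi, memory, ← Finset.prod_pow_eq_pow_sum]
  refine Finset.prod_congr rfl fun i _ => ?_
  rw [Fintype.card_fun, ZMod.card, Fintype.card_fin]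

variable [NeZero s]

/-- The first wrong bit of an error event with difference word `e` is that of source `j`. -/
def EventWord.StartsAt {G : Gen p s} (e : EventWord G) (j : Fin p) : Prop :=
  (∀ k < j, extend e.2.1 0 k = 0) ∧ extend e.2.1 0 j ≠ 0

lemma EventWord.existsUnique_startsAt {G : Gen p s} (e : EventWord G) : ∃! j, e.StartsAt j := by
  classical
  have hne : (Finset.univ.filter fun j => extend e.2.1 0 j ≠ 0).Nonempty := by
    obtain ⟨j, hj⟩ := Function.ne_iff.1 e.2.2.2.1
    exact ⟨j, by simpa using hj⟩
  refine ⟨Finset.min' _ hne, ⟨fun k hk => ?_, ?_⟩, fun j hj => ?_⟩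
  · by_contra h
    exact absurd (Finset.min'_le (Finset.univ.filter fun j => extend e.2.1 0 j ≠ 0) k
      (by simpa using h)) (not_le.2 hk)
  · simpa using Finset.min'_mem _ hne
  · refine le_antisymm (Finset.le_min' _ _ _ fun k hk => ?_) (Finset.min'_le _ _ (by simpa using hj.2))
    by_contra h
    exact (Finset.mem_filter.1 hk).2 (hj.1 k (not_le.1 h))

/-- Error events with given start state and start time are pairs of a difference word and a
transmitted word. -/
def errorEventEquiv (G : Gen p s) (j : Fin p) (σ : JState G) :
    {e : ErrorEvent G // e.StartsAt j ∧ e.start = σ} ≃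
      Σ e : {e : EventWord G // e.StartsAt j}, Msg p e.1.1 where
  toFun e := ⟨⟨⟨e.1.len, e.1.sent - e.1.decoded, e.1.len_pos, by
      rw [extend_sub, Pi.sub_apply, sub_ne_zero]; exact e.1.diverge, fun t h1 h2 => by
      rw [extend_sub, ne_eq, ← isMerged_productState_iff G e.1.start]
      exact e.1.unmerged t h1 h2, by
      rw [extend_sub, ← isMerged_productState_iff G e.1.start]
      exact e.1.merge⟩, by
      have h := e.2.1
      refine ⟨fun k hk => ?_, ?_⟩
      · simp only [extend_sub, Pi.sub_apply, sub_eq_zero]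
        exact h.1 k hk
      · simp only [extend_sub, Pi.sub_apply, ne_eq, sub_eq_zero]
        exact h.2⟩, e.1.sent⟩
  invFun x := ⟨{
      start := σ
      len := x.1.1.1
      sent := x.2
      decoded := x.2 - x.1.1.2.1
      len_pos := x.1.1.2.2.1
      diverge := by
        rw [← sub_ne_zero, ← Pi.sub_apply, ← extend_sub, sub_sub_cancel]
        exact x.1.1.2.2.2.1
      unmerged := fun t h1 h2 => by
        rw [isMerged_productState_iff, ← extend_sub, sub_sub_cancel]
        exact x.1.1.2.2.2.2.1 t h1 h2
      merge := by
        rw [isMerged_productState_iff, ← extend_sub, sub_sub_cancel]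
        exact x.1.1.2.2.2.2.2 }, by
      have h := x.1.2
      refine ⟨⟨fun k hk => ?_, ?_⟩, rfl⟩
      · have := h.1 k hk
        change extend x.2 0 k = extend (x.2 - x.1.1.2.1) 0 k
        rwa [extend_sub, Pi.sub_apply, Pi.sub_apply, eq_comm, sub_eq_self]
      · have := h.2
        change extend x.2 0 j ≠ extend (x.2 - x.1.1.2.1) 0 j
        rwa [extend_sub, Pi.sub_apply, Pi.sub_apply, ne_eq, eq_comm, sub_eq_self]⟩
  left_inv := by
    rintro ⟨⟨start, len, sent, decoded, h1, h2, h3, h4⟩, h5, h6⟩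
    subst h6
    simp
  right_inv := by
    rintro ⟨⟨⟨L, w, hw⟩, hj⟩, u⟩
    simp

lemma eventCount_eq (G : Gen p s) (K : ℕ) (T : ℝ) (j : Fin p) (σ : JState G) (x : ℕ × ℕ × ℝ) :
    eventCount G K T j σ x.1 x.2.1 x.2.2 =
      Nat.card {e : {e : ErrorEvent G // e.StartsAt j ∧ e.start = σ} //
        (p * e.1.len, bitErrors e.1.sent e.1.decoded, e.1.nsed K T) = x} := by
  refine Nat.card_congr
    { toFun := fun e => ⟨⟨e.1, e.2.1, e.2.2.1⟩, by
        obtain ⟨ι, τ, D⟩ := x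
        simpa using e.2.2.2⟩
      invFun := fun e => ⟨e.1.1, e.1.2.1, e.1.2.2, by
        have := e.2
        obtain ⟨ι, τ, D⟩ := x
        simpa using this⟩
      left_inv := fun e => rfl
      right_inv := fun e => rfl }

lemma finite_errorEvent_fiber (G : Gen p s) (hp : 0 < p) (K : ℕ) (T : ℝ) (j : Fin p) (σ : JState G)
    (x : ℕ × ℕ × ℝ) :
    Finite {e : {e : ErrorEvent G // e.StartsAt j ∧ e.start = σ} //
        (p * e.1.len, bitErrors e.1.sent e.1.decoded, e.1.nsed K T) = x} := by
  have hlen : ∀ e : {e : {e : ErrorEvent G // e.StartsAt j ∧ e.start = σ} //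
      (p * e.1.len, bitErrors e.1.sent e.1.decoded, e.1.nsed K T) = x}, e.1.1.len < x.1 + 1 := by
    intro e
    have h := congrArg Prod.fst e.2
    simp only at h
    rw [← h]
    exact Nat.lt_succ_of_le (Nat.le_mul_of_pos_left _ hp)
  refine Finite.of_injective
    (β := Σ L : Fin (x.1 + 1), Msg p L × Msg p L)
    (fun e => ⟨⟨e.1.1.len, hlen e⟩, e.1.1.sent, e.1.1.decoded⟩) ?_
  rintro ⟨⟨⟨start, len, sent, decoded, h1, h2, h3, h4⟩, h5, h6⟩, h7⟩
    ⟨⟨⟨start', len', sent', decoded', h1', h2', h3', h4'⟩, h5', h6'⟩, h7'⟩ h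
  simp only [Sigma.mk.injEq, Fin.mk.injEq] at h
  obtain ⟨hl, h⟩ := h
  subst hl
  simp only [heq_eq_eq, Prod.mk.injEq] at h
  obtain ⟨rfl, rfl⟩ := h
  simp only at h6 h6'
  subst h6
  subst h6'
  rfl

/-- The 2^(pL) transmitted words that share a difference word have equal error count and NSED, and
their number cancels (1/2)^(pL). The result does not involve `σ`. Working in [0, ∞] allows
regrouping without a summability hypothesis. -/
lemma tsum_ofReal_transferTerm (G : Gen p s) (hp : 0 < p) {K : ℕ} (hK : Odd K) {T : ℝ} (hT : 0 < T)
    (j : Fin p) (σ : JState G) (ε ζ : ℝ) :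
    ∑' x, ENNReal.ofReal (transferTerm G K T j σ (1 / 2) ε ζ x) =
      ∑' e : {e : EventWord G // e.StartsAt j},
        ENNReal.ofReal (ε ^ bitErrors e.1.2.1 0 * ζ ^ pathCost G 0 (extend e.1.2.1) e.1.1) := by
  have h1 : ∀ x, ENNReal.ofReal (transferTerm G K T j σ (1 / 2) ε ζ x) =
      (Nat.card {e : {e : ErrorEvent G // e.StartsAt j ∧ e.start = σ} //
        (p * e.1.len, bitErrors e.1.sent e.1.decoded, e.1.nsed K T) = x} : ENNReal) *
        ENNReal.ofReal ((1 / 2) ^ x.1 * (ε ^ x.2.1 * ζ ^ x.2.2)) := by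
    intro x
    rw [transferTerm, eventCount_eq, mul_assoc, mul_assoc, ENNReal.ofReal_mul (by positivity),
      ENNReal.ofReal_natCast]
  simp only [h1]
  rw [tsum_card_fiber (fun e : {e : ErrorEvent G // e.StartsAt j ∧ e.start = σ} =>
      (p * e.1.len, bitErrors e.1.sent e.1.decoded, e.1.nsed K T))
      (finite_errorEvent_fiber G hp K T j σ)
      (fun x => ENNReal.ofReal ((1 / 2) ^ x.1 * (ε ^ x.2.1 * ζ ^ x.2.2))),
    ← (errorEventEquiv G j σ).symm.tsum_eq, ENNReal.tsum_sigma']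
  refine tsum_congr fun e => ?_
  rw [tsum_fintype]
  have h2 : ∀ u : Msg p e.1.1, ENNReal.ofReal
      ((1 / 2) ^ (p * ((errorEventEquiv G j σ).symm ⟨e, u⟩).1.len) *
        (ε ^ bitErrors ((errorEventEquiv G j σ).symm ⟨e, u⟩).1.sent
            ((errorEventEquiv G j σ).symm ⟨e, u⟩).1.decoded *
          ζ ^ ((errorEventEquiv G j σ).symm ⟨e, u⟩).1.nsed K T)) =
      ENNReal.ofReal ((1 / 2) ^ (p * e.1.1) *
        (ε ^ bitErrors e.1.2.1 0 * ζ ^ pathCost G 0 (extend e.1.2.1) e.1.1)) := by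
    intro u
    rw [ErrorEvent.nsed_eq _ hK hT, Real.rpow_natCast, bitErrors_sub]
    change ENNReal.ofReal ((1 / 2) ^ (p * e.1.1) * (ε ^ bitErrors (u - (u - e.1.2.1)) 0 *
      ζ ^ pathCost G 0 (extend (u - (u - e.1.2.1))) e.1.1)) = _
    rw [sub_sub_cancel]
  rw [Finset.sum_congr rfl fun u _ => h2 u, Finset.sum_const, nsmul_eq_mul, Finset.card_univ,
    ← ENNReal.ofReal_natCast, ← ENNReal.ofReal_mul (by positivity)]
  congr 1
  rw [Fintype.card_fun, Fintype.card_fun, ZMod.card, Fintype.card_fin, Fintype.card_fin, ← mul_assoc]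
  push_cast
  rw [← pow_mul, ← mul_pow]
  norm_num

lemma transferTerm_nonneg (G : Gen p s) (K : ℕ) (T : ℝ) (j : Fin p) (σ : JState G) {η ε ζ : ℝ}
    (hη : 0 ≤ η) (hε : 0 ≤ ε) (hζ : 0 ≤ ζ) (x : ℕ × ℕ × ℝ) :
    0 ≤ transferTerm G K T j σ η ε ζ x := by
  unfold transferTerm
  positivity

lemma tsum_transferTerm (G : Gen p s) (hp : 0 < p) {K : ℕ} (hK : Odd K) {T : ℝ} (hT : 0 < T)
    (j : Fin p) (σ : JState G) {ε ζ : ℝ} (hε : 0 ≤ ε) (hζ : 0 ≤ ζ) :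
    ∑' x, transferTerm G K T j σ (1 / 2) ε ζ x =
      ∑' e : {e : EventWord G // e.StartsAt j},
        ε ^ bitErrors e.1.2.1 0 * ζ ^ pathCost G 0 (extend e.1.2.1) e.1.1 := by
  have h := congrArg ENNReal.toReal (tsum_ofReal_transferTerm G hp hK hT j σ ε ζ)
  rw [ENNReal.tsum_toReal_eq (by simp), ENNReal.tsum_toReal_eq (by simp)] at h
  simp only [ENNReal.toReal_ofReal (transferTerm_nonneg G K T j σ (by norm_num : (0 : ℝ) ≤ 1 / 2)
    hε hζ _)] at h
  rw [h]
  exact tsum_congr fun e => ENNReal.toReal_ofReal (by positivity)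

lemma transferFunction_eq (G : Gen p s) (hp : 0 < p) {K : ℕ} (hK : Odd K) {T : ℝ} (hT : 0 < T)
    {ε ζ : ℝ} (hε : 0 ≤ ε) (hζ : 0 ≤ ζ) :
    transferFunction G K T (1 / 2) ε ζ = 1 / p * ∑ j : Fin p,
      ∑' e : {e : EventWord G // e.StartsAt j},
        ε ^ bitErrors e.1.2.1 0 * ζ ^ pathCost G 0 (extend e.1.2.1) e.1.1 := by
  unfold transferFunction
  simp only [tsum_transferTerm G hp hK hT _ _ hε hζ, Finset.sum_const, Finset.card_univ,
    card_jState, nsmul_eq_mul, ← Finset.mul_sum]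
  push_cast
  field_simp

/-- Sorting the difference words by start time. -/
def eventWordEquiv (G : Gen p s) : (Σ j : Fin p, {e : EventWord G // e.StartsAt j}) ≃ EventWord G where
  toFun x := x.2.1
  invFun e := ⟨e.existsUnique_startsAt.choose, e, e.existsUnique_startsAt.choose_spec.1⟩
  left_inv := by
    rintro ⟨j, e, he⟩
    have h : e.existsUnique_startsAt.choose = j :=
      (e.existsUnique_startsAt.choose_spec.2 j he).symm
    ext1
    · exact h
    · subst h
      rfl
  right_inv e := rfl

lemma summable_eventWord_of_transferTerm (G : Gen p s) (hp : 0 < p) {K : ℕ} (hK : Odd K) {T : ℝ}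
    (hT : 0 < T) {ζ : ℝ} (hζ : 0 ≤ ζ)
    (hF : ∀ (j : Fin p) (σ : JState G), Summable (transferTerm G K T j σ (1 / 2) 1 ζ)) :
    Summable fun e : EventWord G => ζ ^ pathCost G 0 (extend e.2.1) e.1 := by
  rw [← (eventWordEquiv G).summable_iff, summable_sigma_of_nonneg fun x => by
    simp only [Function.comp_apply]; positivity]
  refine ⟨fun j => ?_, (hasSum_fintype _).summable⟩
  have h := (hF j 0).tsum_ofReal_ne_top
  rw [tsum_ofReal_transferTerm G hp hK hT j 0 1 ζ] at h
  refine (ENNReal.summable_toReal h).congr fun e => ?_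
  simp only [one_pow, one_mul]
  exact ENNReal.toReal_ofReal (by positivity)

end DistCPFSK
end

noncomputable section

namespace DistCPFSK

variable {p s : ℕ} [NeZero s]

/-! ### Differentiation of the transfer function -/

theorem exists_word_weight_decay_real {G : Gen p s} {ζ : ℝ} (hζ : 0 < ζ)
    (h : Summable fun e : EventWord G => ζ ^ pathCost G 0 (extend e.2.1) e.1) :
    ∃ ρ C : ℝ, 0 ≤ ρ ∧ ρ < 1 ∧ 0 ≤ C ∧ ∀ n,
      (∑ w : Msg p n, open Classical in
        if AvoidsZero G 0 w then ζ ^ pathCost G 0 (extend w) n else 0) ≤ C * ρ ^ n ∧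
      (∑ w : Msg p (n + 1), open Classical in
        if IsEvent G w then ζ ^ pathCost G 0 (extend w) (n + 1) else 0) ≤ C * ρ ^ n := by
  classical
  have h' : ∑' e : EventWord G, ENNReal.ofReal ζ ^ pathCost G 0 (extend e.2.1) e.1 ≠ ⊤ := by
    have := h.tsum_ofReal_ne_top
    simpa only [ENNReal.ofReal_pow hζ.le] using this
  obtain ⟨ρ, C, hρ, hC, hdec⟩ := exists_word_weight_decay (by simpa using hζ)
    ENNReal.ofReal_ne_top h'
  have hρ' : ρ ≠ ⊤ := (hρ.trans ENNReal.one_lt_top).ne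
  refine ⟨ρ.toReal, C.toReal, ENNReal.toReal_nonneg, ?_, ENNReal.toReal_nonneg, fun n => ?_⟩
  · exact (ENNReal.toReal_lt_toReal hρ' ENNReal.one_ne_top).2 hρ
  have hconv : ∀ {L : ℕ} (A : Msg p L → Prop),
      (∑ w : Msg p L, if A w then ENNReal.ofReal ζ ^ pathCost G 0 (extend w) L else 0) ≤ C * ρ ^ n →
      (∑ w : Msg p L, if A w then ζ ^ pathCost G 0 (extend w) L else 0) ≤
        C.toReal * ρ.toReal ^ n := by
    intro L A hA
    have := ENNReal.toReal_mono (ENNReal.mul_ne_top hC (ENNReal.pow_ne_top hρ')) hA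
    rw [ENNReal.toReal_mul, ENNReal.toReal_pow, ENNReal.toReal_sum] at this
    · refine le_of_eq_of_le (Finset.sum_congr rfl fun w _ => ?_) this
      split_ifs
      · rw [ENNReal.toReal_pow, ENNReal.toReal_ofReal hζ.le]
      · rfl
    · intro w _
      split_ifs
      · exact ENNReal.pow_ne_top ENNReal.ofReal_ne_top
      · simp
  exact ⟨hconv _ (hdec n).1, hconv _ (hdec n).2⟩

lemma summable_eventWord_mul {G : Gen p s} {ζ ρ C : ℝ} (hζ : 0 < ζ)
    (hdec : ∀ n, (∑ w : Msg p (n + 1), open Classical in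
        if IsEvent G w then ζ ^ pathCost G 0 (extend w) (n + 1) else 0) ≤ C * ρ ^ n)
    {f : ℕ → ℝ} (hf : ∀ n, 0 ≤ f n) (hsum : Summable fun n => f (n + 1) * ρ ^ n) :
    Summable fun e : EventWord G => f e.1 * ζ ^ pathCost G 0 (extend e.2.1) e.1 := by
  classical
  rw [summable_sigma_of_nonneg fun e => mul_nonneg (hf _) (by positivity)]
  refine ⟨fun L => (hasSum_fintype _).summable, ?_⟩
  rw [← summable_nat_add_iff 1]
  refine Summable.of_nonneg_of_le
    (fun n => tsum_nonneg fun w => mul_nonneg (hf _) (by positivity)) (fun n => ?_)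
    (hsum.mul_left C)
  rw [tsum_fintype]
  simp only [← Finset.mul_sum]
  calc f (n + 1) * ∑ w : {w : Msg p (n + 1) // IsEvent G w}, ζ ^ pathCost G 0 (extend w.1) (n + 1)
      = f (n + 1) * ∑ w : Msg p (n + 1),
        if IsEvent G w then ζ ^ pathCost G 0 (extend w) (n + 1) else 0 := by
        rw [← Finset.sum_filter]
        congr 1
        exact (Finset.sum_subtype _ (by simp)
          (fun w : Msg p (n + 1) => ζ ^ pathCost G 0 (extend w) (n + 1))).symm
    _ ≤ f (n + 1) * (C * ρ ^ n) := by gcongr; exacts [hf _, hdec n]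
    _ = C * (f (n + 1) * ρ ^ n) := by ring

/-- Exponential decay with ratio ρ < 1 leaves room for some r > 1 with r^p ρ < 1. An event of `L`
steps has at most `p * L` bit errors, so this dominates the ε-derivatives of all terms for 0 < ε <
r. -/
lemma exists_summable_majorant {G : Gen p s} {ζ : ℝ} (hζ : 0 < ζ)
    (h : Summable fun e : EventWord G => ζ ^ pathCost G 0 (extend e.2.1) e.1) :
    ∃ r : ℝ, 1 < r ∧ Summable fun e : EventWord G =>
      (p * e.1 : ℝ) * r ^ (p * e.1) * ζ ^ pathCost G 0 (extend e.2.1) e.1 := by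
  obtain ⟨ρ, C, hρ0, hρ1, hC, hdec⟩ := exists_word_weight_decay_real hζ h
  obtain ⟨r, hr1, hr⟩ : ∃ r : ℝ, 1 < r ∧ r ^ p * ρ < 1 := by
    have hc : Tendsto (fun r : ℝ => r ^ p * ρ) (nhdsWithin 1 (Set.Ioi 1)) (nhds (1 ^ p * ρ)) :=
      ((continuous_pow p).mul continuous_const).continuousWithinAt
    rw [one_pow, one_mul] at hc
    have := (hc.eventually_lt_const hρ1).and self_mem_nhdsWithin
    obtain ⟨r, h1, h2⟩ := this.exists
    exact ⟨r, h2, h1⟩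
  refine ⟨r, hr1, summable_eventWord_mul hζ (fun n => (hdec n).2)
    (f := fun n => (p * n : ℝ) * r ^ (p * n)) (fun n => by positivity) ?_⟩
  have hθ : ‖r ^ p * ρ‖ < 1 := by
    rwa [Real.norm_of_nonneg (by positivity)]
  have h1 := summable_pow_mul_geometric_of_norm_lt_one 1 hθ
  have h0 := summable_pow_mul_geometric_of_norm_lt_one 0 hθ
  refine ((h1.add h0).mul_left (p * r ^ p)).congr fun n => ?_
  rw [mul_pow, ← pow_mul, mul_add p n 1, pow_add]
  push_cast
  ring

theorem hasDerivAt_transferFunction (G : Gen p s) (hp : 0 < p) {K : ℕ} (hK : Odd K) {T : ℝ}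
    (hT : 0 < T) {ζ : ℝ} (hζ : 0 < ζ)
    (h : Summable fun e : EventWord G => ζ ^ pathCost G 0 (extend e.2.1) e.1) :
    (Summable fun e : EventWord G =>
      (bitErrors e.2.1 0 : ℝ) * ζ ^ pathCost G 0 (extend e.2.1) e.1) ∧
    HasDerivAt (fun ε => transferFunction G K T (1 / 2) ε ζ)
      (1 / p * ∑' e : EventWord G, (bitErrors e.2.1 0 : ℝ) * ζ ^ pathCost G 0 (extend e.2.1) e.1)
      1 := by
  obtain ⟨r, hr, hmaj⟩ := exists_summable_majorant hζ h
  have hτ : ∀ e : EventWord G, (bitErrors e.2.1 0 : ℝ) ≤ p * e.1 := fun e => by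
    exact_mod_cast bitErrors_le e.2.1 0
  have hsum : Summable fun e : EventWord G =>
      (bitErrors e.2.1 0 : ℝ) * ζ ^ pathCost G 0 (extend e.2.1) e.1 := by
    refine Summable.of_nonneg_of_le (fun e => by positivity) (fun e => ?_) hmaj
    gcongr
    exact (hτ e).trans (le_mul_of_one_le_right (by positivity) (one_le_pow₀ hr.le))
  refine ⟨hsum, ?_⟩
  have hj : ∀ j : Fin p, HasDerivAt (fun ε : ℝ => ∑' e : {e : EventWord G // e.StartsAt j},
      ε ^ bitErrors e.1.2.1 0 * ζ ^ pathCost G 0 (extend e.1.2.1) e.1.1)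
      (∑' e : {e : EventWord G // e.StartsAt j},
        (bitErrors e.1.2.1 0 : ℝ) * ζ ^ pathCost G 0 (extend e.1.2.1) e.1.1) 1 := by
    intro j
    have := hasDerivAt_tsum_of_isPreconnected
      (g := fun (e : {e : EventWord G // e.StartsAt j}) (ε : ℝ) =>
        ε ^ bitErrors e.1.2.1 0 * ζ ^ pathCost G 0 (extend e.1.2.1) e.1.1)
      (g' := fun e ε => (bitErrors e.1.2.1 0 * ε ^ (bitErrors e.1.2.1 0 - 1)) *
        ζ ^ pathCost G 0 (extend e.1.2.1) e.1.1) (t := Set.Ioo 0 r) (y₀ := 1) (y := 1)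
      (hmaj.subtype {e : EventWord G | e.StartsAt j}) isOpen_Ioo isPreconnected_Ioo
      (fun e y _ => (hasDerivAt_pow _ y).mul_const _) (fun e y hy => ?_) ⟨one_pos, hr⟩ ?_
      ⟨one_pos, hr⟩
    · simpa only [one_pow, mul_one] using this
    · rw [Real.norm_of_nonneg (by have := hy.1; positivity)]
      simp only [Function.comp_apply]
      have hy0 := hy.1.le
      gcongr
      · exact hτ e.1
      · calc y ^ (bitErrors e.1.2.1 0 - 1) ≤ r ^ (bitErrors e.1.2.1 0 - 1) := by
              gcongr; exact hy.2.le
          _ ≤ r ^ (p * e.1.1) := by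
              refine pow_le_pow_right₀ hr.le ((Nat.sub_le _ _).trans (bitErrors_le _ _))
    · simp only [one_pow, one_mul]
      exact h.subtype {e : EventWord G | e.StartsAt j}
  have hall := (HasDerivAt.fun_sum fun (j : Fin p) (_ : j ∈ Finset.univ) => hj j).const_mul
    (1 / (p : ℝ))
  have hval : ∑' e : EventWord G, (bitErrors e.2.1 0 : ℝ) * ζ ^ pathCost G 0 (extend e.2.1) e.1 =
      ∑ j : Fin p, ∑' e : {e : EventWord G // e.StartsAt j},
        (bitErrors e.1.2.1 0 : ℝ) * ζ ^ pathCost G 0 (extend e.1.2.1) e.1.1 := by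
    rw [← (eventWordEquiv G).tsum_eq]
    refine (Summable.tsum_sigma (((eventWordEquiv G).summable_iff).2 hsum)).trans ?_
    rw [tsum_fintype]
    rfl
  rw [hval]
  refine hall.congr_of_eventuallyEq ?_
  filter_upwards [lt_mem_nhds (zero_lt_one' ℝ)] with ε hε
  exact transferFunction_eq G hp hK hT hε.le hζ.le

end DistCPFSK
end

noncomputable section

namespace DistCPFSK

variable {p s : ℕ}

/-! ### Segmentation of a difference sequence into error events -/

/-- Number of nonzero bits. -/
def hammingWeight (a : Inp p) : ℕ := (Finset.univ.filter fun i => a i ≠ 0).card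

lemma bitErrors_eq_sum {N : ℕ} (u : Msg p N) (d : ℕ → Inp p) (h : ∀ t : Fin N, u t = d t) :
    bitErrors u 0 = ∑ t ∈ Finset.range N, hammingWeight (d t) := by
  rw [← Fin.sum_univ_eq_sum_range (fun t => hammingWeight (d t)), bitErrors, Finset.card_filter,
    Fintype.sum_prod_type]
  refine Finset.sum_congr rfl fun t _ => ?_
  rw [hammingWeight, Finset.card_filter, ← h t]
  rfl

/-- The word of length `L` at time `a` in an input sequence. -/
def window (d : ℕ → Inp p) (a L : ℕ) : Msg p L := fun i => d (a + i)

lemma extend_window (d : ℕ → Inp p) (a : ℕ) {L t : ℕ} (h : t < L) :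
    extend (window d a L) t = d (a + t) := by
  rw [extend_of_lt _ h]
  rfl

/-- A word started at time `a`. -/
def placeAt (a : ℕ) {L : ℕ} (w : Msg p L) (n : ℕ) : Inp p := if n < a then 0 else extend w (n - a)

variable [NeZero s]

/-- In a block of `N` steps, the word `w` at time `a` is an error event or an unterminated error
event. -/
def IsSegment (G : Gen p s) (N a : ℕ) {L : ℕ} (w : Msg p L) : Prop :=
  (a + L ≤ N ∧ IsEvent G w) ∨ (a + L = N ∧ AvoidsZero G 0 w)

lemma dState_window {G : Gen p s} {d : ℕ → Inp p} {a : ℕ} (ha : dState G 0 d a = 0) {L t : ℕ}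
    (h : t ≤ L) : dState G 0 (extend (window d a L)) t = dState G 0 d (a + t) := by
  rw [dState_add_steps, ha]
  exact dState_congr G 0 fun i hi => extend_window d a (hi.trans_le h)

/-- The excursion containing `t` starts at the last zero of the trajectory up to `t` and ends at the
first zero after `t`, or with the block if there is none. -/
lemma exists_segment (G : Gen p s) (d : ℕ → Inp p) {N t : ℕ} (ht : t < N) (hd : d t ≠ 0) :
    ∃ a L, a ≤ t ∧ t < a + L ∧ a + L ≤ N ∧ dState G 0 d a = 0 ∧ IsSegment G N a (window d a L) := by
  classical
  set a := Nat.findGreatest (fun a => dState G 0 d a = 0) t with ha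
  have ha0 : dState G 0 d a = 0 :=
    Nat.findGreatest_spec (P := fun a => dState G 0 d a = 0) (Nat.zero_le t) rfl
  have hat : a ≤ t := Nat.findGreatest_le t
  have hun : ∀ k, a < k → k ≤ t → dState G 0 d k ≠ 0 := fun k h1 h2 =>
    Nat.findGreatest_is_greatest h1 h2
  -- Zero input at `a` would keep the trajectory at 0 at time `a + 1`, against `d t ≠ 0` if `a = t`
  -- and against the maximality of `a` otherwise.
  have hda : d a ≠ 0 := by
    intro h0
    have h1 : dState G 0 d (a + 1) = 0 := by rw [dState, ha0, h0, dStep_zero]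
    rcases hat.eq_or_lt with h | h
    · exact hd (h ▸ h0)
    · exact hun (a + 1) (by omega) (by omega) h1
  by_cases hex : ∃ b, t < b ∧ b ≤ N ∧ dState G 0 d b = 0
  · obtain ⟨hb1, hb2, hb3⟩ := Nat.find_spec hex
    have hmin := fun m => Nat.find_min hex (m := m)
    set b := Nat.find hex
    refine ⟨a, b - a, hat, by omega, by omega, ha0, Or.inl ⟨by omega, by omega, ?_, ?_, ?_⟩⟩
    · rwa [extend_window d a (by omega)]
    · intro k h1 h2
      rw [dState_window ha0 h2.le]
      intro h3
      rcases le_or_gt (a + k) t with h4 | h4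
      · exact hun _ (by omega) h4 h3
      · exact hmin (a + k) (by omega) ⟨h4, by omega, h3⟩
    · rw [dState_window ha0 le_rfl, Nat.add_sub_cancel' (by omega), hb3]
  · push Not at hex
    refine ⟨a, N - a, hat, by omega, by omega, ha0, Or.inr ⟨by omega, ?_⟩⟩
    intro k h1 h2
    rw [dState_window ha0 h2]
    rcases le_or_gt (a + k) t with h4 | h4
    · exact hun _ (by omega) h4
    · exact hex _ h4 (by omega)

/-- Every wrong bit is covered by at least one segment. Double counting is harmless for an upper
bound, so uniqueness of the segmentation is not needed. -/
lemma sum_hammingWeight_le (G : Gen p s) (d : ℕ → Inp p) (N : ℕ) :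
    ∑ t ∈ Finset.range N, hammingWeight (d t) ≤
      ∑ a ∈ Finset.range N, ∑ L ∈ Finset.range (N + 1), open Classical in
        if dState G 0 d a = 0 ∧ IsSegment G N a (window d a L) then bitErrors (window d a L) 0
        else 0 := by
  classical
  set A : ℕ → ℕ → Prop := fun a L => dState G 0 d a = 0 ∧ IsSegment G N a (window d a L)
  have h1 : ∀ t ∈ Finset.range N, hammingWeight (d t) ≤
      ∑ a ∈ Finset.range N, ∑ L ∈ Finset.range (N + 1),
        if A a L ∧ a ≤ t ∧ t < a + L then hammingWeight (d t) else 0 := by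
    intro t ht
    rw [Finset.mem_range] at ht
    by_cases hd : d t = 0
    · simp [hd, hammingWeight]
    · obtain ⟨a, L, h1, h2, h3, h4, h5⟩ := exists_segment G d ht hd
      refine le_trans ?_ (Finset.single_le_sum
        (f := fun a => ∑ L ∈ Finset.range (N + 1),
          if A a L ∧ a ≤ t ∧ t < a + L then hammingWeight (d t) else 0)
        (fun _ _ => Nat.zero_le _) (Finset.mem_range.2 (by omega : a < N)))
      refine le_trans ?_ (Finset.single_le_sum
        (f := fun L => if A a L ∧ a ≤ t ∧ t < a + L then hammingWeight (d t) else 0)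
        (fun _ _ => Nat.zero_le _) (Finset.mem_range.2 (by omega : L < N + 1)))
      rw [if_pos ⟨⟨h4, h5⟩, h1, h2⟩]
  refine (Finset.sum_le_sum h1).trans ?_
  rw [Finset.sum_comm]
  refine Finset.sum_le_sum fun a _ => ?_
  rw [Finset.sum_comm]
  refine Finset.sum_le_sum fun L _ => ?_
  by_cases hA : A a L
  · rw [if_pos hA, bitErrors_eq_sum (window d a L) (fun i => d (a + i)) fun _ => rfl]
    simp only [hA, true_and]
    rw [← Finset.sum_filter]
    have h2 := Finset.sum_Ico_eq_sum_range (fun t => hammingWeight (d t)) a (a + L)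
    rw [Nat.add_sub_cancel_left] at h2
    rw [← h2]
    refine Finset.sum_le_sum_of_subset fun t ht => ?_
    rw [Finset.mem_filter] at ht
    exact Finset.mem_Ico.2 ht.2
  · simp [hA]

/-! ### Exchanging one segment -/

lemma dState_placeAt (G : Gen p s) (a : ℕ) {L : ℕ} (w : Msg p L) (t : ℕ) :
    dState G 0 (placeAt a w) (a + t) = dState G 0 (extend w) t := dState_delay G (extend w) a t

lemma dState_placeAt_of_le (G : Gen p s) {a t : ℕ} {L : ℕ} (w : Msg p L) (h : t ≤ a) :
    dState G 0 (placeAt a w) t = 0 := by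
  rw [dState_congr G 0 (v := 0) fun i hi => by simp [placeAt, hi.trans_le h], dState_zero_zero]

lemma dCost_zero (G : Gen p s) : dCost G 0 0 = 0 := by
  have h : stepBits G 0 0 = 0 := by simpa using stepBits_sub G 0 0 0 0
  have h2 : ∀ k, rscState 0 k = 0 := fun k => by simpa using rscState_sub 0 0 k
  simp [dCost, h, h2, symCost]

lemma dState_extend_eq_zero {G : Gen p s} {L : ℕ} {w : Msg p L} (h : dState G 0 (extend w) L = 0)
    (t : ℕ) : dState G 0 (extend w) (L + t) = 0 := by
  rw [dState_add_steps, h, dState_congr G 0 (v := 0) fun i _ => by simp [extend], dState_zero_zero]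

lemma pathCost_zero (G : Gen p s) (t : ℕ) : pathCost G 0 0 t = 0 :=
  Finset.sum_eq_zero fun i _ => by rw [dState_zero_zero, Pi.zero_apply, dCost_zero]

lemma pathCost_placeAt {G : Gen p s} {N a L : ℕ} {w : Msg p L} (h : IsSegment G N a w) :
    pathCost G 0 (placeAt a w) N = pathCost G 0 (extend w) L := by
  have haL : a + L ≤ N := by rcases h with h | h; exacts [h.1, h.1.le]
  obtain ⟨r, rfl⟩ := Nat.exists_eq_add_of_le haL
  rw [add_assoc, pathCost_add_steps, dState_placeAt_of_le G w le_rfl,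
    pathCost_congr G 0 (u := placeAt a w) (v := 0) fun i hi => by simp [placeAt, hi],
    pathCost_zero, zero_add, pathCost_congr G 0 (v := extend w) fun i _ => by simp [placeAt]]
  rcases h with h | h
  · rw [pathCost_add_steps, h.2.2.2.2,
      pathCost_congr G 0 (u := fun n => extend w (L + n)) (v := 0) fun i _ => by simp [extend],
      pathCost_zero, add_zero]
  · have hr : r = 0 := by omega
    rw [hr, add_zero]

lemma symbol_eq_zero {G : Gen p s} {f : ℕ → Inp p} {n : ℕ} (h1 : dState G 0 f (n / s) = 0)
    (h2 : f (n / s) = 0) : symbol G 0 f n = 0 ∧ rscState (symbol G 0 f) n = 0 := by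
  have hz : stepBits G (0 : JState G) 0 = 0 := by simpa using stepBits_sub G 0 0 0 0
  have hz2 : ∀ k, rscState 0 k = 0 := fun k => by simpa using rscState_sub 0 0 k
  rw [dState_zero_eq, Prod.mk_eq_zero] at h1
  have hn : n / s * s + n % s = n := by rw [mul_comm]; exact Nat.div_add_mod n s
  have hk : n % s < s := Nat.mod_lt _ (NeZero.pos s)
  constructor
  · rw [← hn, symbol_block G 0 f _ hk, h1.1, h2, hz]
    rfl
  · rw [← hn, rscState_symbol_block G 0 f _ hk.le, h1.1, h1.2, h2, hz, hz2, add_zero]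

lemma envelope_eq_of_sub {G : Gen p s} (K : ℕ) {T t : ℝ} {x y f : ℕ → Inp p} (hf : x - y = f)
    (h1 : dState G 0 f (⌊t / T⌋₊ / s) = 0) (h2 : f (⌊t / T⌋₊ / s) = 0) :
    envelope G K T 0 x t = envelope G K T 0 y t := by
  obtain ⟨h3, h4⟩ := symbol_eq_zero h1 h2
  have h5 := symbol_sub G 0 0 x y
  rw [hf, sub_zero] at h5
  rw [h5, Pi.sub_apply, sub_eq_zero] at h3
  rw [h5, rscState_sub, sub_eq_zero] at h4
  simp only [envelope, phase, h3, h4]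

/-- Exchanging a segment in the decoded path has the same effect as inserting it into the
transmitted path. -/
lemma signal_exchange {G : Gen p s} (K : ℕ) {T : ℝ} (hT : 0 < T) (Es : ℝ) {N : ℕ} {u v e : Msg p N}
    {a L : ℕ} {w : Msg p L} (he : extend e = placeAt a w) (hw : IsSegment G N a w)
    (ha : dState G 0 (extend (u - v)) a = 0) (hwin : w = window (extend (u - v)) a L) :
    signal G K T Es v - signal G K T Es (v + e) =
      signal G K T Es (u - e) - signal G K T Es u := by
  funext t
  simp only [Pi.sub_apply, signal, Set.indicator]
  split_ifs with ht
  swap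
  · simp
  set n := ⌊t / T⌋₊
  have hext : extend (v + e) = extend v + extend e := by
    have := extend_sub (v + e) e
    rw [add_sub_cancel_right] at this
    rw [this, sub_add_cancel]
  -- Inside the window `v + e` produces the signal of `u` and `u - e` that of `v`, so both sides are
  -- s_v - s_u. Outside, `e` has no effect and both sides vanish.
  by_cases hn : a ≤ n / s ∧ n / s < a + L
  · obtain ⟨r, hr⟩ := Nat.exists_eq_add_of_le hn.1
    have hrL : r < L := by omega
    have h1 : dState G 0 (extend (u - v) - extend e) (n / s) = 0 := by
      have := dState_sub G 0 0 (extend (u - v)) (extend e) (n / s)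
      rw [sub_zero] at this
      rw [this, he, hr, dState_placeAt, hwin, dState_window ha hrL.le, sub_self]
    have h2 : (extend (u - v) - extend e) (n / s) = 0 := by
      rw [Pi.sub_apply, he, hr]
      simp only [placeAt, add_lt_iff_neg_left, not_lt_zero, if_false, add_tsub_cancel_left]
      rw [hwin, extend_window _ _ hrL, sub_self]
    rw [envelope_eq_of_sub K (x := extend u) (y := extend (v + e)) _ h1 h2,
      envelope_eq_of_sub K (x := extend (u - e)) (y := extend v) _ h1 h2]
    · rw [extend_sub, extend_sub]; abel
    · rw [hext, extend_sub]; abel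
  · have h12 : dState G 0 (extend e) (n / s) = 0 ∧ extend e (n / s) = 0 := by
      rw [he]
      rcases lt_or_ge (n / s) a with h | h
      · exact ⟨dState_placeAt_of_le G w h.le, by simp [placeAt, h]⟩
      · obtain ⟨r, hr⟩ := Nat.exists_eq_add_of_le h
        have hrL : L ≤ r := by omega
        obtain ⟨q, rfl⟩ := Nat.exists_eq_add_of_le hrL
        refine ⟨?_, by simp [placeAt, hr, extend]⟩
        rcases hw with hw | hw
        · rw [hr, dState_placeAt, dState_extend_eq_zero hw.2.2.2.2]
        -- An unterminated segment ends with the block, so no signal time lies after it.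
        · exfalso
          have hlt : n < N * s := by
            rw [Nat.floor_lt (div_nonneg ht.1 hT.le), div_lt_iff₀ hT]
            push_cast
            exact ht.2
          have := (Nat.div_lt_iff_lt_mul (NeZero.pos s)).2 hlt
          omega
    rw [envelope_eq_of_sub K (x := extend (v + e)) (y := extend v) _ h12.1 h12.2,
      envelope_eq_of_sub K (x := extend u) (y := extend (u - e)) _ h12.1 h12.2]
    · simp
    · rw [extend_sub]; abel
    · rw [hext]; abel

end DistCPFSK
end

noncomputable section

namespace DistCPFSK

variable {p s : ℕ}

/-! ### Union bound -/

/-- The part of a word placed at time `a` that lies in a block of `N` steps. -/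
def blockOf (N a : ℕ) {L : ℕ} (w : Msg p L) : Msg p N := fun t => placeAt a w t

lemma extend_blockOf {N a L : ℕ} (h : a + L ≤ N) (w : Msg p L) :
    extend (blockOf N a w) = placeAt a w := by
  funext t
  rcases lt_or_ge t N with ht | ht
  · rw [extend_of_lt _ ht]
    rfl
  · have h1 : ¬ t < a := by omega
    have h2 : ¬ t - a < L := by omega
    have h3 : ¬ t < N := by omega
    simp [extend, placeAt, h1, h2, h3]

variable [NeZero s]

lemma IsSegment.le {G : Gen p s} {N a L : ℕ} {w : Msg p L} (h : IsSegment G N a w) : a + L ≤ N := by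
  rcases h with h | h
  exacts [h.1, h.1.le]

/-- An event is a terminated nonzero input, so some relay bit is nonzero and costs 1. This is where
linear independence of the generators enters. -/
lemma pathCost_pos_of_isEvent {G : Gen p s} (hG : LinearIndependent (ZMod 2)[X] G) {L : ℕ}
    {w : Msg p L} (hw : IsEvent G w) : pathCost G 0 (extend w) L ≠ 0 := by
  intro h0
  have hst := hw.2.2.2
  rw [dState_zero_eq, Prod.mk_eq_zero] at hst
  obtain ⟨t, ht, k, hk⟩ := exists_outBit_ne_zero hG (u := extend w) (L := L)
    (fun t ht => by simp [extend, not_lt.2 ht]) hst.1 (fun h => hw.2.1 (by rw [h]; rfl))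
  have h1 := pathCost_eq G 0 (extend w) L
  rw [show ((0 : JState G), (0 : ZMod 2)) = 0 from rfl, h0, eq_comm, Finset.sum_eq_zero_iff] at h1
  have h2 := h1 (t * s + k) (by
    rw [Finset.mem_range]
    calc t * s + k < t * s + s := by gcongr; exact k.2
      _ = (t + 1) * s := by ring
      _ ≤ L * s := by gcongr; omega)
  have h3 : symbol G 0 (extend w) (t * s + k) ≠ 0 := by
    rw [symbol_block G 0 (extend w) t k.2, stepBits]
    convert hk
    ext
    simp [Fin.ofNat, Nat.mod_eq_of_lt k.2]
  rw [symCost, if_pos h3] at h2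
  exact one_ne_zero h2

/-! ### Pairwise error events of single segments and the union bound for one block. -/

section Channel

variable {Ω : Type*} [MeasurableSpace Ω] {P : Measure Ω} {N0 : ℝ}
  {Z : (ℝ → ℂ) → Ω → ℝ}

/-- The event that the block with the segment `w` at time `a` is at least as likely as the
transmitted block `u`. -/
def segmentError (G : Gen p s) (K : ℕ) (T Es : ℝ) (Z : (ℝ → ℂ) → Ω → ℝ) {N : ℕ} (u : Msg p N)
    (a : ℕ) {L : ℕ} (w : Msg p L) : Set Ω :=
  {ω | received G K T Es Z u ω u ≤ received G K T Es Z u ω (u - blockOf N a w)}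

lemma pathCost_sub_blockOf {G : Gen p s} {N a L : ℕ} {w : Msg p L} (h : IsSegment G N a w)
    (u : Msg p N) : pathCost G 0 (extend (u - blockOf N a w) - extend u) N =
      pathCost G 0 (extend w) L := by
  rw [extend_sub, extend_blockOf h.le, ← pathCost_placeAt h]
  congr 1
  funext t i
  simp [ZModModule.neg_eq_self]

lemma nullMeasurableSet_segmentError (hZ : IsWhiteNoise P N0 Z) (G : Gen p s) (K : ℕ) (T Es : ℝ)
    {N : ℕ} (u : Msg p N) (a : ℕ) {L : ℕ} (w : Msg p L) :
    NullMeasurableSet (segmentError G K T Es Z u a w) P := by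
  have h := fun v : Msg p N => (hZ.memLp (memLp_signal G K T Es v)).aestronglyMeasurable.aemeasurable
  exact nullMeasurableSet_le ((h _).const_add _) ((h _).const_add _)

variable [IsProbabilityMeasure P]

lemma measureReal_segmentError_of_isEvent (hZ : IsWhiteNoise P N0 Z) (hN0 : 0 < N0) {G : Gen p s}
    (hG : LinearIndependent (ZMod 2)[X] G) {K : ℕ} (hK : Odd K) {T Es : ℝ} (hT : 0 < T)
    (hEs : 0 < Es) {N : ℕ} (u : Msg p N) {a L : ℕ} {w : Msg p L} (ha : a + L ≤ N)
    (hw : IsEvent G w) :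
    P.real (segmentError G K T Es Z u a w) =
      gaussQ (√(pathCost G 0 (extend w) L * (Es / N0))) := by
  have hseg : IsSegment G N a w := Or.inl ⟨ha, hw⟩
  have h := measureReal_pairwise_error hZ hN0 G hK hT hEs u (u - blockOf N a w)
    (by rw [pathCost_sub_blockOf hseg]; exact pathCost_pos_of_isEvent hG hw)
  rwa [pathCost_sub_blockOf hseg] at h

/-- Unterminated segments may have distance 0; then the bound is the trivial 1. -/
lemma measureReal_segmentError_le (hZ : IsWhiteNoise P N0 Z) (hN0 : 0 < N0) {G : Gen p s}
    {K : ℕ} (hK : Odd K) {T Es : ℝ} (hT : 0 < T) (hEs : 0 < Es) {N : ℕ} (u : Msg p N) {a L : ℕ}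
    {w : Msg p L} (hw : IsSegment G N a w) :
    P.real (segmentError G K T Es Z u a w) ≤
      Real.exp (-(Es / N0 / 2)) ^ pathCost G 0 (extend w) L := by
  by_cases h0 : pathCost G 0 (extend w) L = 0
  · rw [h0, pow_zero]
    exact measureReal_le_one
  · have h := measureReal_pairwise_error hZ hN0 G hK hT hEs u (u - blockOf N a w)
      (by rwa [pathCost_sub_blockOf hw])
    rw [pathCost_sub_blockOf hw] at h
    refine h.le.trans ((gaussQ_sqrt_le (by positivity)).trans (le_of_eq ?_))
    rw [← Real.exp_nat_mul]
    congr 1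
    ring

/-- The decision `v` beats its corrected version `v + e`. By `signal_exchange` and almost sure
linearity of the noise, that comparison is the one of `u - e` with `u`. The resulting event no
longer mentions the decision. -/
lemma ae_mem_segmentError (hZ : IsWhiteNoise P N0 Z) (G : Gen p s) (K : ℕ) {T : ℝ} (hT : 0 < T)
    (Es : ℝ) {N : ℕ} {dec : (Msg p N → ℝ) → Msg p N} (hdec : IsMLSD G K T Es dec) (u : Msg p N) :
    ∀ᵐ ω ∂P, ∀ (a L : ℕ) (w : Msg p L), IsSegment G N a w →
      dState G 0 (extend (u - dec (received G K T Es Z u ω))) a = 0 →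
      w = window (extend (u - dec (received G K T Es Z u ω))) a L →
      ω ∈ segmentError G K T Es Z u a w := by
  have hs := fun v : Msg p N => memLp_signal G K T Es v
  -- The decision depends on `ω`, so one null set must serve all pairs of blocks; there are finitely
  -- many.
  have hae : ∀ᵐ ω ∂P, ∀ v e : Msg p N,
      signal G K T Es v - signal G K T Es (v + e) = signal G K T Es (u - e) - signal G K T Es u →
      Z (signal G K T Es v) ω - Z (signal G K T Es (v + e)) ω =
        Z (signal G K T Es (u - e)) ω - Z (signal G K T Es u) ω := by
    rw [ae_all_iff]
    intro v
    rw [ae_all_iff]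
    intro e
    by_cases h : signal G K T Es v - signal G K T Es (v + e) =
        signal G K T Es (u - e) - signal G K T Es u
    · filter_upwards [hZ.sub_ae_eq (hs v) (hs (v + e)) (hs (u - e)) (hs u) h] with ω hω _
      exact hω
    · exact Eventually.of_forall fun ω h' => absurd h' h
  filter_upwards [hae] with ω hω a L w hw ha hwin
  set v := dec (received G K T Es Z u ω) with hv
  set e := blockOf N a w
  have hsig := signal_exchange K hT Es (u := u) (v := v) (e := e) (extend_blockOf hw.le w) hw ha hwin
  have hz := hω v e hsig
  have hmax := hdec.maximal (received G K T Es Z u ω) (v + e)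
  rw [← hv, corr_signal_self G K T Es (v + e) v] at hmax
  have hcorr := congrArg (corr (signal G K T Es u)) hsig
  rw [corr_sub_right (hs u) (hs v) (hs _), corr_sub_right (hs u) (hs _) (hs u)] at hcorr
  change received G K T Es Z u ω u ≤ received G K T Es Z u ω (u - e)
  simp only [received] at hmax ⊢
  linarith

lemma integral_bitErrors_le (hZ : IsWhiteNoise P N0 Z) (G : Gen p s) (K : ℕ) {T : ℝ} (hT : 0 < T)
    (Es : ℝ) {N : ℕ} {dec : (Msg p N → ℝ) → Msg p N} (hdec : IsMLSD G K T Es dec) (u : Msg p N) :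
    ∫ ω, (bitErrors u (dec (received G K T Es Z u ω)) : ℝ) ∂P ≤
      ∑ a ∈ Finset.range N, ∑ L ∈ Finset.range (N + 1), ∑ w : Msg p L, open Classical in
        if IsSegment G N a w then
          (bitErrors w 0 : ℝ) * P.real (segmentError G K T Es Z u a w) else 0 := by
  classical
  have hint : ∀ (a L : ℕ) (w : Msg p L), Integrable (fun ω =>
      if IsSegment G N a w then (segmentError G K T Es Z u a w).indicator
        (fun _ => (bitErrors w 0 : ℝ)) ω else 0) P := by
    intro a L w
    split_ifs
    · exact (integrable_const _).indicator₀ (nullMeasurableSet_segmentError hZ G K T Es u a w)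
    · exact integrable_zero _ _ _
  have hval : ∀ (a L : ℕ) (w : Msg p L), ∫ ω,
      (if IsSegment G N a w then (segmentError G K T Es Z u a w).indicator
        (fun _ => (bitErrors w 0 : ℝ)) ω else 0) ∂P =
      if IsSegment G N a w then
          (bitErrors w 0 : ℝ) * P.real (segmentError G K T Es Z u a w) else 0 := by
    intro a L w
    split_ifs
    · rw [integral_indicator₀ (nullMeasurableSet_segmentError hZ G K T Es u a w)]
      simp [mul_comm]
    · simp
  have hint3 := fun (a L : ℕ) => integrable_finsetSum Finset.univ
    fun (w : Msg p L) _ => hint a L w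
  have hint2 := fun a : ℕ => integrable_finsetSum (Finset.range (N + 1)) fun L _ => hint3 a L
  have hint1 := integrable_finsetSum (Finset.range N) fun a _ => hint2 a
  refine (integral_mono_of_nonneg (Eventually.of_forall fun ω => Nat.cast_nonneg _) hint1
    ?_).trans (le_of_eq ?_)
  · filter_upwards [ae_mem_segmentError hZ G K hT Es hdec u] with ω hω
    set v := dec (received G K T Es Z u ω)
    rw [bitErrors_sub, bitErrors_eq_sum (u - v) (extend (u - v)) fun t => by
      rw [extend_of_lt _ t.2]]
    refine (Nat.cast_le.2 (sum_hammingWeight_le G (extend (u - v)) N)).trans ?_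
    push_cast
    refine Finset.sum_le_sum fun a _ => Finset.sum_le_sum fun L _ => ?_
    have hnn : ∀ w : Msg p L, 0 ≤ (if IsSegment G N a w then
        (segmentError G K T Es Z u a w).indicator (fun _ => (bitErrors w 0 : ℝ)) ω else 0) := by
      intro w
      split_ifs
      · exact Set.indicator_nonneg (fun _ _ => Nat.cast_nonneg _) _
      · exact le_rfl
    split_ifs with h
    · refine le_trans (le_of_eq ?_) (Finset.single_le_sum (fun w _ => hnn w)
        (Finset.mem_univ (window (extend (u - v)) a L)))
      rw [if_pos h.2, Set.indicator_of_mem (hω a L _ h.2 h.1 rfl)]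
    · exact_mod_cast Finset.sum_nonneg fun w _ => hnn w
  · rw [integral_finsetSum _ fun a _ => hint2 a]
    refine Finset.sum_congr rfl fun a _ => ?_
    rw [integral_finsetSum _ fun L _ => hint3 a L]
    refine Finset.sum_congr rfl fun L _ => ?_
    rw [integral_finsetSum _ fun w _ => hint a L w]
    exact Finset.sum_congr rfl fun w _ => hval a L w

end Channel

end DistCPFSK
end

noncomputable section

namespace DistCPFSK

variable {p s : ℕ} [NeZero s]

/-! ### Bit error probability -/

lemma summable_bitErrors_mul_gaussQ {G : Gen p s} {c : ℝ} (hc : 0 < c)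
    (h : Summable fun e : EventWord G =>
      (bitErrors e.2.1 0 : ℝ) * Real.exp (-(c / 2)) ^ pathCost G 0 (extend e.2.1) e.1) :
    Summable fun e : EventWord G =>
      (bitErrors e.2.1 0 : ℝ) * gaussQ (√(pathCost G 0 (extend e.2.1) e.1 * c)) := by
  refine Summable.of_nonneg_of_le
    (fun e => mul_nonneg (Nat.cast_nonneg _) (gaussQ_pos _).le) (fun e => ?_) h
  gcongr
  refine (gaussQ_sqrt_le (by positivity)).trans (le_of_eq ?_)
  rw [← Real.exp_nat_mul]
  congr 1
  ring

lemma exists_integral_bitErrors_le {Ω : Type*} [MeasurableSpace Ω] {P : Measure Ω}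
    [IsProbabilityMeasure P] {N0 : ℝ} {Z : (ℝ → ℂ) → Ω → ℝ} (hZ : IsWhiteNoise P N0 Z)
    (hN0 : 0 < N0) {G : Gen p s} (hG : LinearIndependent (ZMod 2)[X] G) {K : ℕ} (hK : Odd K)
    {T Es : ℝ} (hT : 0 < T) (hEs : 0 < Es)
    (hdecay : Summable fun e : EventWord G =>
      Real.exp (-(Es / N0 / 2)) ^ pathCost G 0 (extend e.2.1) e.1)
    (hsum : Summable fun e : EventWord G =>
      (bitErrors e.2.1 0 : ℝ) * gaussQ (√(pathCost G 0 (extend e.2.1) e.1 * (Es / N0)))) :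
    ∃ B : ℝ, ∀ (N : ℕ) (dec : (Msg p N → ℝ) → Msg p N), IsMLSD G K T Es dec → ∀ u : Msg p N,
      ∫ ω, (bitErrors u (dec (received G K T Es Z u ω)) : ℝ) ∂P ≤
        N * (∑' e : EventWord G,
          (bitErrors e.2.1 0 : ℝ) * gaussQ (√(pathCost G 0 (extend e.2.1) e.1 * (Es / N0)))) +
        B := by
  classical
  set ζ := Real.exp (-(Es / N0 / 2)) with hζ
  set Q : (L : ℕ) → Msg p L → ℝ := fun L w => gaussQ (√(pathCost G 0 (extend w) L * (Es / N0)))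
  obtain ⟨ρ, C, hρ0, hρ1, hC, hdec⟩ := exists_word_weight_decay_real (Real.exp_pos _) hdecay
  have hgeo : Summable fun L : ℕ => (p * L : ℝ) * (C * ρ ^ L) := by
    have h1 := summable_pow_mul_geometric_of_norm_lt_one 1
      (show ‖ρ‖ < 1 by rwa [Real.norm_of_nonneg hρ0])
    refine (h1.mul_left (p * C)).congr fun n => ?_
    ring
  -- This constant bounds the unterminated segments uniformly in `N`: for each length `L` only the
  -- position `a = N - L` is possible, and at most `p * L` bits are wrong.
  refine ⟨∑' L : ℕ, (p * L : ℝ) * (C * ρ ^ L), fun N dec hML u => ?_⟩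
  refine (integral_bitErrors_le hZ G K hT Es hML u).trans ?_
  have hterm : ∀ (a L : ℕ) (w : Msg p L),
      (if IsSegment G N a w then
        (bitErrors w 0 : ℝ) * P.real (segmentError G K T Es Z u a w) else 0) ≤
      (if IsEvent G w then (bitErrors w 0 : ℝ) * Q L w else 0) +
        (if a + L = N then p * L * (if AvoidsZero G 0 w then ζ ^ pathCost G 0 (extend w) L else 0)
          else 0) := by
    intro a L w
    have hQ : 0 ≤ Q L w := (gaussQ_pos _).le
    have h1 : 0 ≤ (if IsEvent G w then (bitErrors w 0 : ℝ) * Q L w else 0) := by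
      split_ifs <;> positivity
    have h2 : 0 ≤ (if a + L = N then
        (p * L : ℝ) * (if AvoidsZero G 0 w then ζ ^ pathCost G 0 (extend w) L else 0) else 0) := by
      split_ifs <;> positivity
    by_cases hseg : IsSegment G N a w
    · rw [if_pos hseg]
      rcases hseg with hw | hw
      · refine le_add_of_le_of_nonneg ?_ h2
        rw [if_pos hw.2, measureReal_segmentError_of_isEvent hZ hN0 hG hK hT hEs u hw.1 hw.2]
      · refine le_add_of_nonneg_of_le h1 ?_
        rw [if_pos hw.1, if_pos hw.2]
        refine mul_le_mul ?_ (measureReal_segmentError_le hZ hN0 hK hT hEs u (Or.inr hw))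
          measureReal_nonneg (by positivity)
        exact_mod_cast bitErrors_le w 0
    · rw [if_neg hseg]
      exact add_nonneg h1 h2
  refine (Finset.sum_le_sum fun a _ => Finset.sum_le_sum fun L _ => Finset.sum_le_sum fun w _ =>
    hterm a L w).trans ?_
  simp only [Finset.sum_add_distrib]
  refine add_le_add ?_ ?_
  · have h1 : ∑ L ∈ Finset.range (N + 1), ∑ w : Msg p L,
        (if IsEvent G w then (bitErrors w 0 : ℝ) * Q L w else 0) ≤
        ∑' e : EventWord G, (bitErrors e.2.1 0 : ℝ) * Q e.1 e.2.1 := by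
      rw [Summable.tsum_sigma hsum]
      have h2 : ∀ L : ℕ, ∑ w : Msg p L, (if IsEvent G w then (bitErrors w 0 : ℝ) * Q L w else 0) =
          ∑' w : {w : Msg p L // IsEvent G w}, (bitErrors w.1 0 : ℝ) * Q L w.1 := by
        intro L
        rw [tsum_fintype, ← Finset.sum_filter]
        exact Finset.sum_subtype _ (by simp) (fun w : Msg p L => (bitErrors w 0 : ℝ) * Q L w)
      simp only [h2]
      exact hsum.sigma.sum_le_tsum (Finset.range (N + 1)) fun L _ =>
        tsum_nonneg fun w => mul_nonneg (Nat.cast_nonneg _) (gaussQ_pos _).le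
    rw [Finset.sum_const, Finset.card_range, nsmul_eq_mul]
    gcongr
  · rw [Finset.sum_comm]
    refine le_trans (Finset.sum_le_sum fun L hL => ?_)
      (hgeo.sum_le_tsum (Finset.range (N + 1)) fun L _ => by positivity)
    have h3 : ∀ a : ℕ, ∑ w : Msg p L, (if a + L = N then
        (p * L : ℝ) * (if AvoidsZero G 0 w then ζ ^ pathCost G 0 (extend w) L else 0) else 0) ≤
        if a = N - L then (p * L : ℝ) * (C * ρ ^ L) else 0 := by
      intro a
      rw [Finset.mem_range] at hL
      by_cases h : a + L = N
      · simp only [h, if_true]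
        rw [if_pos (by omega), ← Finset.mul_sum]
        gcongr
        exact (hdec L).1
      · simp only [h, if_false, Finset.sum_const_zero]
        split_ifs <;> positivity
    refine (Finset.sum_le_sum fun a _ => h3 a).trans ?_
    rw [Finset.sum_ite_eq']
    split_ifs
    · exact le_rfl
    · positivity

lemma bitErrorProb_le {Ω : Type*} [MeasurableSpace Ω] (P : Measure Ω) {G : Gen p s} (hp : 0 < p)
    (K : ℕ) (T Es : ℝ) (Z : (ℝ → ℂ) → Ω → ℝ) (dec : (N : ℕ) → (Msg p N → ℝ) → Msg p N) {A B : ℝ}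
    (h : ∀ (N : ℕ) (u : Msg p N),
      ∫ ω, (bitErrors u (dec N (received G K T Es Z u ω)) : ℝ) ∂P ≤ N * A + B) :
    bitErrorProb P G K T Es Z dec ≤ 1 / p * A := by
  have hp' : (0 : ℝ) < p := by exact_mod_cast hp
  have hle : ∀ᶠ N : ℕ in atTop,
      blockBER P G K T Es Z (dec N) ≤ 1 / p * A + B / p * (N : ℝ)⁻¹ := by
    filter_upwards [eventually_gt_atTop 0] with N hN
    have hN' : (0 : ℝ) < N := by exact_mod_cast hN
    have hsum : ∑ u : Msg p N, ∫ ω, (bitErrors u (dec N (received G K T Es Z u ω)) : ℝ) /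
        ((p : ℝ) * N) ∂P ≤ 2 ^ (p * N) * ((N * A + B) / (p * N)) := by
      refine (Finset.sum_le_card_nsmul _ _ ((N * A + B) / (p * N)) fun u _ => ?_).trans
        (le_of_eq ?_)
      · rw [integral_div]
        gcongr
        exact h N u
      · rw [Finset.card_univ, Fintype.card_fun, Fintype.card_fun, ZMod.card, Fintype.card_fin,
          Fintype.card_fin, nsmul_eq_mul, ← pow_mul]
        push_cast
        rfl
    calc blockBER P G K T Es Z (dec N)
        ≤ (2 ^ (p * N) : ℝ)⁻¹ * (2 ^ (p * N) * ((N * A + B) / (p * N))) := by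
          unfold blockBER
          gcongr
      _ = 1 / p * A + B / p * (N : ℝ)⁻¹ := by
          field_simp
  have hlim : Tendsto (fun N : ℕ => 1 / p * A + B / p * (N : ℝ)⁻¹) atTop (nhds (1 / p * A)) := by
    have h1 := (tendsto_inv_atTop_nhds_zero_nat (𝕜 := ℝ)).const_mul (B / p)
    simpa using h1.const_add (1 / p * A)
  unfold bitErrorProb
  rw [← hlim.limsup_eq]
  refine limsup_le_limsup hle ?_ hlim.isBoundedUnder_le
  -- A real `limsup` is only monotone given boundedness; nonnegativity of the error rates supplies
  -- the lower bound.
  refine IsBoundedUnder.isCoboundedUnder_le ⟨0, ?_⟩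
  rw [eventually_map]
  refine Eventually.of_forall fun N => ?_
  unfold blockBER
  exact mul_nonneg (by positivity) (Finset.sum_nonneg fun u _ =>
    integral_nonneg fun ω => by positivity)

/-! ### Minimum distance -/

lemma exists_nsed_eq {G : Gen p s} {K : ℕ} (hK : Odd K) {T : ℝ} (hT : 0 < T) (e : EventWord G) :
    ∃ E : ErrorEvent G, E.nsed K T = pathCost G 0 (extend e.2.1) e.1 := by
  obtain ⟨j, hj, -⟩ := e.existsUnique_startsAt
  refine ⟨((errorEventEquiv G j 0).symm ⟨⟨e, hj⟩, 0⟩).1, ?_⟩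
  rw [ErrorEvent.nsed_eq _ hK hT]
  exact congrArg (fun w : Msg p e.1 => ((pathCost G 0 (extend w) e.1 : ℕ) : ℝ))
    (sub_sub_cancel (0 : Msg p e.1) e.2.1)

lemma dminSq_nonneg (G : Gen p s) {K : ℕ} (hK : Odd K) {T : ℝ} (hT : 0 < T) :
    0 ≤ dminSq G K T := by
  refine Real.sInf_nonneg ?_
  rintro _ ⟨E, rfl⟩
  simp only [E.nsed_eq hK hT]
  positivity

lemma dminSq_le {G : Gen p s} {K : ℕ} (hK : Odd K) {T : ℝ} (hT : 0 < T) (e : EventWord G) :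
    dminSq G K T ≤ pathCost G 0 (extend e.2.1) e.1 := by
  obtain ⟨E, hE⟩ := exists_nsed_eq hK hT e
  rw [← hE]
  refine csInf_le ⟨0, ?_⟩ ⟨E, rfl⟩
  rintro _ ⟨E', rfl⟩
  simp only [E'.nsed_eq hK hT]
  positivity

/-- A source with memory that is fed ones has a nonzero newest register bit, so `n + 1` all-one
inputs keep the trajectory off 0. Controllability then steers it back, and the first return closes
an event longer than `n`. -/
lemma exists_eventWord_len_gt {G : Gen p s} (hm : 0 < memory G) (n : ℕ) :
    ∃ e : EventWord G, n < e.1 := by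
  classical
  obtain ⟨i, hi⟩ : ∃ i, 0 < mem G i := by
    by_contra! h
    exact hm.ne' (Finset.sum_eq_zero fun i _ => Nat.le_zero.1 (h i))
  set c : ℕ → Inp p := fun _ => 1 with hc
  have hne : ∀ {q : ℕ → Inp p} {t : ℕ}, q t = 1 → dState G 0 q (t + 1) ≠ 0 := by
    intro q t hq h0
    rw [dState, dStep, hq, Prod.mk_eq_zero] at h0
    have := congrFun (congrFun h0.1 i) ⟨0, hi⟩
    simp [nextState] at this
  obtain ⟨v, t, hv⟩ := Reachable.exists_dState_eq_zero (G := G) ⟨c, n + 1, rfl⟩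
  set q : ℕ → Inp p := fun k => if k < n + 1 then 1 else v (k - (n + 1)) with hq
  have hqn : dState G 0 q (n + 1 + t) = 0 := by
    rw [dState_add_steps, dState_congr G 0 (u := q) (v := c) fun k hk => if_pos hk]
    refine (congrArg (fun x => dState G _ x t) (funext fun k => ?_)).trans hv
    simp only [hq]
    rw [if_neg (by omega), Nat.add_sub_cancel_left]
  have hex : ∃ b, 0 < b ∧ dState G 0 q b = 0 := ⟨n + 1 + t, by omega, hqn⟩
  obtain ⟨hb0, hb⟩ := Nat.find_spec hex
  have hmin := fun m => Nat.find_min hex (m := m)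
  set b := Nat.find hex
  have hbn : n < b := by
    by_contra! h
    obtain ⟨k, hk⟩ := Nat.exists_eq_succ_of_ne_zero hb0.ne'
    rw [hk] at hb
    exact hne (if_pos (by omega)) hb
  have hz : dState G 0 q 0 = 0 := rfl
  refine ⟨⟨b, window q 0 b, hb0, ?_, fun k h1 h2 => ?_, ?_⟩, hbn⟩
  · rw [extend_window q 0 hb0]
    simp only [hq, add_zero, Nat.zero_lt_succ, if_true]
    exact fun h => one_ne_zero (congrFun h i)
  · rw [dState_window hz h2.le, zero_add]
    exact fun h => hmin k h2 ⟨h1, h⟩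
  · rw [dState_window hz le_rfl, zero_add, hb]

lemma infinite_eventWord {G : Gen p s} (hm : 0 < memory G) : Infinite (EventWord G) := by
  by_contra h
  rw [not_infinite_iff_finite] at h
  obtain ⟨n, hn⟩ := (Set.finite_range fun e : EventWord G => e.1).bddAbove
  obtain ⟨e, he⟩ := exists_eventWord_len_gt hm n
  exact absurd (hn ⟨e, rfl⟩) (not_le.2 he)

/-- The terms of a convergent series over infinitely many events tend to 0, so the distances are
unbounded. -/
lemma exists_lt_pathCost {G : Gen p s} (hm : 0 < memory G) {c : ℝ} (hc : 0 < c)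
    (h : Summable fun e : EventWord G =>
      Real.exp (-(c / 2)) ^ pathCost G 0 (extend e.2.1) e.1) (D : ℝ) :
    ∃ e : EventWord G, D < pathCost G 0 (extend e.2.1) e.1 := by
  have := infinite_eventWord hm
  obtain ⟨e, he⟩ := (h.tendsto_cofinite_zero.eventually_lt_const
    (Real.exp_pos (-(c / 2) * D))).exists
  refine ⟨e, ?_⟩
  rw [← Real.exp_nat_mul, Real.exp_lt_exp] at he
  nlinarith

lemma bitErrors_pos {G : Gen p s} (e : EventWord G) : 0 < bitErrors e.2.1 0 := by
  obtain ⟨j, hj⟩ := Function.ne_iff.1 e.2.2.2.1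
  rw [extend_of_lt _ e.2.2.1] at hj
  exact Finset.card_pos.2 ⟨(⟨0, e.2.2.1⟩, j), by simpa using hj⟩

/-- Termwise this is `gaussQ_le_mul_exp` with a² = d_min² c and b² = D c; an event with D > d_min²
makes one term strict. -/
lemma tsum_gaussQ_lt {G : Gen p s} (hm : 0 < memory G) {K : ℕ} (hK : Odd K) {T : ℝ} (hT : 0 < T)
    {c : ℝ} (hc : 0 < c)
    (h0 : Summable fun e : EventWord G =>
      Real.exp (-(c / 2)) ^ pathCost G 0 (extend e.2.1) e.1)
    (h1 : Summable fun e : EventWord G =>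
      (bitErrors e.2.1 0 : ℝ) * Real.exp (-(c / 2)) ^ pathCost G 0 (extend e.2.1) e.1) :
    ∑' e : EventWord G,
      (bitErrors e.2.1 0 : ℝ) * gaussQ (√(pathCost G 0 (extend e.2.1) e.1 * c)) <
    gaussQ (√(dminSq G K T * c)) * Real.exp (dminSq G K T * (c / 2)) * ∑' e : EventWord G,
      (bitErrors e.2.1 0 : ℝ) * Real.exp (-(c / 2)) ^ pathCost G 0 (extend e.2.1) e.1 := by
  have hd := dminSq_nonneg G hK hT
  set δ := dminSq G K T
  have hexp : ∀ D : ℕ, gaussQ (√(δ * c)) * Real.exp ((√(δ * c) ^ 2 - √(D * c) ^ 2) / 2) =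
      gaussQ (√(δ * c)) * Real.exp (δ * (c / 2)) * Real.exp (-(c / 2)) ^ D := by
    intro D
    rw [Real.sq_sqrt (by positivity), Real.sq_sqrt (by positivity), mul_assoc, ← Real.exp_nat_mul,
      ← Real.exp_add]
    congr 2
    ring
  obtain ⟨e₀, he₀⟩ := exists_lt_pathCost hm hc h0 δ
  rw [← tsum_mul_left]
  refine Summable.tsum_lt_tsum (i := e₀) (fun e => ?_) ?_ (summable_bitErrors_mul_gaussQ hc h1)
    (h1.mul_left _)
  · simp only
    rw [mul_left_comm, ← hexp]
    gcongr
    refine gaussQ_le_mul_exp (Real.sqrt_le_sqrt ?_)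
    gcongr
    exact dminSq_le hK hT e
  · rw [mul_left_comm, ← hexp]
    refine mul_lt_mul_of_pos_left (gaussQ_lt_mul_exp (Real.sqrt_lt_sqrt (by positivity) ?_))
      (by exact_mod_cast bitErrors_pos e₀)
    gcongr

end DistCPFSK
end

/-! ### Assembly of the bound, with c = Es/N0 and ζ = exp(-c/2). -/

theorem theorem1 {p s : ℕ} [NeZero s] (G : DistCPFSK.Gen p s)
    (hG : LinearIndependent (Polynomial (ZMod 2)) G) (hm : 0 < DistCPFSK.memory G)
    (K : ℕ) (hK : Odd K) (T Eb N0 r Es ζ : ℝ) (hT : 0 < T) (hEb : 0 < Eb) (hN0 : 0 < N0)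
    (hr : r = (p : ℝ) / s) (hEs : Es = r * Eb) (hζ : ζ = Real.exp (-(Eb * r / (2 * N0))))
    {Ω : Type*} [MeasurableSpace Ω] (P : MeasureTheory.Measure Ω)
    [MeasureTheory.IsProbabilityMeasure P]
    (Z : (ℝ → ℂ) → Ω → ℝ) (hZ : DistCPFSK.IsWhiteNoise P N0 Z)
    (dec : (N : ℕ) → (DistCPFSK.Msg p N → ℝ) → DistCPFSK.Msg p N)
    (hdec : ∀ N, DistCPFSK.IsMLSD G K T Es (dec N))
    (hF : ∀ (j : Fin p) (σ : DistCPFSK.JState G),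
      Summable (DistCPFSK.transferTerm G K T j σ (1 / 2) 1 ζ)) :
    DifferentiableAt ℝ (fun ε => DistCPFSK.transferFunction G K T (1 / 2) ε ζ) 1 ∧
    DistCPFSK.bitErrorProb P G K T Es Z dec <
      DistCPFSK.gaussQ (√(DistCPFSK.dminSq G K T * (Eb * r / N0))) *
        Real.exp (DistCPFSK.dminSq G K T * (Eb * r / (2 * N0))) *
        deriv (fun ε => DistCPFSK.transferFunction G K T (1 / 2) ε ζ) 1 := by
  -- With no sources the total memory would be an empty sum.
  have hp : 0 < p := by
    rcases Nat.eq_zero_or_pos p with rfl | h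
    · simp [DistCPFSK.memory] at hm
    · exact h
  have hp' : (0 : ℝ) < p := by exact_mod_cast hp
  have hs : (0 : ℝ) < s := by exact_mod_cast NeZero.pos s
  have hr0 : 0 < r := by rw [hr]; positivity
  have hEs0 : 0 < Es := by rw [hEs]; positivity
  have hc : 0 < Es / N0 := by positivity
  have hζ' : ζ = Real.exp (-(Es / N0 / 2)) := by
    rw [hζ, hEs]
    congr 1
    field_simp
  have h0 := DistCPFSK.summable_eventWord_of_transferTerm G hp hK hT
    (by rw [hζ]; positivity : (0 : ℝ) ≤ ζ) hF
  obtain ⟨h1, hderiv⟩ := DistCPFSK.hasDerivAt_transferFunction G hp hK hT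
    (by rw [hζ]; positivity : 0 < ζ) h0
  refine ⟨hderiv.differentiableAt, ?_⟩
  rw [hderiv.deriv]
  rw [hζ'] at h0 h1 ⊢
  obtain ⟨B, hB⟩ := DistCPFSK.exists_integral_bitErrors_le hZ hN0 hG hK hT hEs0 h0
    (DistCPFSK.summable_bitErrors_mul_gaussQ hc h1)
  refine (DistCPFSK.bitErrorProb_le P hp K T Es Z dec fun N u => hB N (dec N) (hdec N) u).trans_lt ?_
  have hlt := DistCPFSK.tsum_gaussQ_lt hm hK hT hc h0 h1
  rw [show Eb * r / N0 = Es / N0 by rw [hEs, mul_comm],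
    show Eb * r / (2 * N0) = Es / N0 / 2 by rw [hEs]; field_simp, mul_left_comm]
  exact mul_lt_mul_of_pos_left hlt (by positivity)
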